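/- Let $\mathbb{R}_+=(0,\infty)$ and let $\sigma,\alpha\in L^\infty(\mathbb{R}_+)$ be real-valued. On $L^2(\mathbb{R}^2_+)$ (complex-valued functions on the quarter plane $\mathbb{R}_+^2$) consider the quadratic form with domain $H^1(\mathbb{R}^2_+)$, $$q^{\infty}_{\alpha,\sigma}[\varphi]=\int_{\mathbb{R}^2_+}|\nabla\varphi|^2\,\mathrm{d}x-\int_0^\infty\sigma(y)\left(|\varphi(y,0)|^2+|\varphi(0,y)|^2\right)\mathrm{d}y+\int_0^\infty\alpha(y)\,|\varphi(y,y)|^2\,\mathrm{d}y ,$$ where $\varphi(y,0)$, $\varphi(0,y)$ and $\varphi(y,y)$ denote the $L^2$-traces of $\varphi$ on the two boundary half-lines and on the diagonal. This form is closed and bounded from below. Let $-\Delta^{d=\infty}_{\sigma,\alpha}$ be the self-adjoint operator associated with it: $\varphi$ is in its domain with $-\Delta^{d=\infty}_{\sigma,\alpha}\varphi=f\in L^2(\mathbb{R}_+^2)$ if and only if $\varphi\in H^1(\mathbb{R}^2_+)$ and $q^{\infty}_{\alpha,\sigma}(\psi,\varphi)=\langle\psi,f\rangle$ for all $\psi\in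 H^1(\mathbb{R}^2_+)$, where $q^{\infty}_{\alpha,\sigma}(\cdot,\cdot)$ is the corresponding sesquilinear form, antilinear in its first argument. Let $\sigma_{ess}$ denote the essential spectrum, that is, the spectrum without the isolated eigenvalues of finite multiplicity. **Theorem.** For all real-valued $\sigma,\alpha\in L^\infty(\mathbb{R}_+)$ one has $$[0,\infty)\subset\sigma_{ess}(-\Delta^{d=\infty}_{\sigma,\alpha}).$$ If, moreover, $\sigma(y)\to0$ and $\alpha(y)\to0$ as $y\to\infty$ (in the essential sense: for every $\varepsilon>0$ there is an $R>0$ such that $|\sigma(y)|,|\alpha(y)|<\varepsilon$ for almost every $y>R$), then $$\sigma_{ess}(-\Delta^{d=\infty}_{\sigma,\alpha})=[0,\infty).$$ -/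

import Mathlib

open MeasureTheory Set Filter Topology
open scoped ENNReal ContDiff ComplexConjugate

namespace QuarterPlane

/-! ### Function spaces on the quarter plane -/

/-- The (open) quarter plane `ℝ₊² = (0,∞) × (0,∞)`. -/
def quadrant : Set (ℝ × ℝ) := Ioi 0 ×ˢ Ioi 0

/-- Lebesgue measure on the quarter plane. -/
noncomputable abbrev μQ : Measure (ℝ × ℝ) := volume.restrict quadrant

/-- Lebesgue measure on the half-line `ℝ₊ = (0,∞)`. -/
noncomputable abbrev μR : Measure ℝ := volume.restrict (Ioi 0)

/-- The complex Hilbert space `L²(ℝ₊²)`. -/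
abbrev L2Q : Type := Lp ℂ 2 μQ

/-- The complex Hilbert space `L²(ℝ₊)`. -/
abbrev L2R : Type := Lp ℂ 2 μR

/-- The real space `L^∞(ℝ₊)`. -/
abbrev LinfR : Type := Lp ℝ ∞ μR

/-- `g` is the weak (distributional) derivative of `φ` in direction `e` on the open quarter plane:
`∫ φ ∂ₑη = - ∫ g η` for all test functions `η ∈ C_c^∞(ℝ₊²)`. -/
def HasWeakDeriv (e : ℝ × ℝ) (φ g : L2Q) : Prop :=
  ∀ η : ℝ × ℝ → ℂ, ContDiff ℝ ∞ η → HasCompactSupport η → tsupport η ⊆ quadrant →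
    ∫ p, φ p * fderiv ℝ η p e ∂μQ = - ∫ p, g p * η p ∂μQ

/-- Let `φ ∈ H¹(ℝ₊²)` have the weak gradient `(φx, φy)`, and let `c` parametrise a curve in the
closed quarter plane. `g ∈ L²(ℝ₊)` is the trace of `φ` along `c` if there are functions `η n`,
smooth up to the boundary (restrictions of elements of `C_c^∞(ℝ²)`), which converge to `φ` in
`H¹(ℝ₊²)` and whose restrictions to the curve converge to `g` in `L²(ℝ₊)`. -/
def HasTrace (c : ℝ → ℝ × ℝ) (φ φx φy : L2Q) (g : L2R) : Prop :=
  ∃ η : ℕ → ℝ × ℝ → ℂ,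
    (∀ n, ContDiff ℝ ∞ (η n) ∧ HasCompactSupport (η n)) ∧
    Tendsto (fun n => eLpNorm (fun p => η n p - φ p) 2 μQ) atTop (𝓝 0) ∧
    Tendsto (fun n => eLpNorm (fun p => fderiv ℝ (η n) p (1, 0) - φx p) 2 μQ) atTop (𝓝 0) ∧
    Tendsto (fun n => eLpNorm (fun p => fderiv ℝ (η n) p (0, 1) - φy p) 2 μQ) atTop (𝓝 0) ∧
    Tendsto (fun n => eLpNorm (fun y => η n (c y) - g y) 2 μR) atTop (𝓝 0)

/-- An element of the Sobolev space `H¹(ℝ₊²)`, listed together with its weak gradient and with its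
traces `y ↦ φ(y,0)`, `y ↦ φ(0,y)` and `y ↦ φ(y,y)`. (By the trace theorem every `φ ∈ L²` with weak
partial derivatives in `L²` has these traces, and gradient and traces are determined by `φ`.) -/
structure H1Function where
  toL2 : L2Q
  dx : L2Q
  dy : L2Q
  bottom : L2R
  left : L2R
  diag : L2R
  hasWeakDeriv_dx : HasWeakDeriv (1, 0) toL2 dx
  hasWeakDeriv_dy : HasWeakDeriv (0, 1) toL2 dy
  hasTrace_bottom : HasTrace (fun y => (y, 0)) toL2 dx dy bottom
  hasTrace_left : HasTrace (fun y => (0, y)) toL2 dx dy left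
  hasTrace_diag : HasTrace (fun y => (y, y)) toL2 dx dy diag

/-- The sesquilinear form (antilinear in the first argument) whose quadratic form is
`q[φ] = ∫ |∇φ|² - ∫ σ(y) (|φ(y,0)|² + |φ(0,y)|²) dy + ∫ α(y) |φ(y,y)|² dy`, with domain `H¹`. -/
noncomputable def form (σ α : LinfR) (v u : H1Function) : ℂ :=
  ∫ p, (conj (v.dx p) * u.dx p + conj (v.dy p) * u.dy p) ∂μQ
    - ∫ y, (σ y : ℂ) * (conj (v.bottom y) * u.bottom y + conj (v.left y) * u.left y) ∂μR
    + ∫ y, (α y : ℂ) * (conj (v.diag y) * u.diag y) ∂μR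

/-! ### Linearity, needed to see that the form defines a linear operator -/

lemma integrable_conj_mul {X : Type*} [MeasurableSpace X] {μ : Measure X} (f g : Lp ℂ 2 μ) :
    Integrable (fun x => conj (f x) * g x) μ := by
  have h := L2.integrable_inner (𝕜 := ℂ) f g
  refine h.congr (Eventually.of_forall fun x => ?_)
  simp [mul_comm]

lemma integrable_weight (σ : LinfR) (f g : L2R) :
    Integrable (fun y => (σ y : ℂ) * (conj (f y) * g y)) μR := by
  have hσ : MemLp (fun y => (σ y : ℂ)) ∞ μR := (Lp.memLp σ).ofReal
  exact (integrable_conj_mul f g).mul_of_top_right hσ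

lemma integrable_mul_test (φ : L2Q) {η : ℝ × ℝ → ℂ} (hη : Continuous η)
    (hc : HasCompactSupport η) : Integrable (fun p => φ p * η p) μQ := by
  have h : MemLp η 2 μQ := hη.memLp_of_hasCompactSupport hc
  exact (Lp.memLp φ).integrable_mul h

lemma continuous_dir {η : ℝ × ℝ → ℂ} (hη : ContDiff ℝ ∞ η) (e : ℝ × ℝ) :
    Continuous (fun p => fderiv ℝ η p e) :=
  (hη.continuous_fderiv (by simp)).clm_apply continuous_const

lemma HasWeakDeriv.lin {e : ℝ × ℝ} {φ g φ' g' : L2Q} (h : HasWeakDeriv e φ g)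
    (h' : HasWeakDeriv e φ' g') (a : ℂ) : HasWeakDeriv e (a • φ + φ') (a • g + g') := by
  intro η h1 h2 h3
  have key : ∀ (f f' : L2Q) (θ : ℝ × ℝ → ℂ), Continuous θ → HasCompactSupport θ →
      ∫ p, (a • f + f') p * θ p ∂μQ = a * ∫ p, f p * θ p ∂μQ + ∫ p, f' p * θ p ∂μQ := by
    intro f f' θ hθ hc
    rw [← integral_const_mul, ← integral_add ((integrable_mul_test f hθ hc).const_mul a)
      (integrable_mul_test f' hθ hc)]
    refine integral_congr_ae ?_
    filter_upwards [Lp.coeFn_add (a • f) f', Lp.coeFn_smul a f] with p e1 e2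
    rw [e1, Pi.add_apply, e2, Pi.smul_apply, smul_eq_mul]
    ring
  rw [key _ _ _ (continuous_dir h1 e) (h2.fderiv_apply ℝ e), key _ _ _ h1.continuous h2,
    h η h1 h2 h3, h' η h1 h2 h3]
  ring

lemma tendsto_lin {X : Type*} [MeasurableSpace X] {μ : Measure X} {F F' G : ℕ → X → ℂ}
    {f f' : Lp ℂ 2 μ} (a : ℂ) (hF : ∀ n, AEStronglyMeasurable (F n) μ)
    (hF' : ∀ n, AEStronglyMeasurable (F' n) μ) (hG : ∀ n x, G n x = a * F n x + F' n x)
    (h : Tendsto (fun n => eLpNorm (fun p => F n p - f p) 2 μ) atTop (𝓝 0))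
    (h' : Tendsto (fun n => eLpNorm (fun p => F' n p - f' p) 2 μ) atTop (𝓝 0)) :
    Tendsto (fun n => eLpNorm (fun p => G n p - (a • f + f') p) 2 μ) atTop (𝓝 0) := by
  have hlim : Tendsto (fun n => ‖a‖ₑ * eLpNorm (fun p => F n p - f p) 2 μ
      + eLpNorm (fun p => F' n p - f' p) 2 μ) atTop (𝓝 0) := by
    have h1 := ENNReal.Tendsto.const_mul (a := ‖a‖ₑ) h (Or.inr enorm_ne_top)
    simpa using h1.add h'
  refine tendsto_of_tendsto_of_tendsto_of_le_of_le tendsto_const_nhds hlim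
    (fun _ => zero_le) (fun n => ?_)
  have e : eLpNorm (fun p => G n p - (a • f + f') p) 2 μ
      = eLpNorm ((a • fun p => F n p - f p) + fun p => F' n p - f' p) 2 μ := by
    refine eLpNorm_congr_ae ?_
    filter_upwards [Lp.coeFn_add (a • f) f', Lp.coeFn_smul a f] with p e1 e2
    rw [e1, Pi.add_apply, e2, hG]
    simp only [Pi.smul_apply, Pi.add_apply, smul_eq_mul]
    ring
  have m : AEStronglyMeasurable (fun p => F n p - f p) μ := (hF n).sub (Lp.aestronglyMeasurable f)
  have m' : AEStronglyMeasurable (fun p => F' n p - f' p) μ :=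
    (hF' n).sub (Lp.aestronglyMeasurable f')
  simp only [e]
  refine (eLpNorm_add_le (m.const_smul a) m' (by norm_num)).trans ?_
  rw [eLpNorm_const_smul]

lemma HasTrace.lin {c : ℝ → ℝ × ℝ} (hc : Continuous c) {φ φx φy φ' φx' φy' : L2Q} {g g' : L2R}
    (h : HasTrace c φ φx φy g) (h' : HasTrace c φ' φx' φy' g') (a : ℂ) :
    HasTrace c (a • φ + φ') (a • φx + φx') (a • φy + φy') (a • g + g') := by
  obtain ⟨η, h0, h1, h2, h3, h4⟩ := h
  obtain ⟨θ, k0, k1, k2, k3, k4⟩ := h'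
  have d : ∀ n p e, fderiv ℝ (fun q => a * η n q + θ n q) p e
      = a * fderiv ℝ (η n) p e + fderiv ℝ (θ n) p e := by
    intro n p e
    have d1 : DifferentiableAt ℝ (η n) p := (h0 n).1.differentiable (by simp) p
    have d2 : DifferentiableAt ℝ (θ n) p := (k0 n).1.differentiable (by simp) p
    rw [fderiv_fun_add (d1.const_mul a) d2, fderiv_const_mul d1]
    simp
  refine ⟨fun n q => a * η n q + θ n q,
    fun n => ⟨(contDiff_const.mul (h0 n).1).add (k0 n).1, ((h0 n).2.mul_left).add (k0 n).2⟩,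
    ?_, ?_, ?_, ?_⟩
  · exact tendsto_lin a (fun n => (h0 n).1.continuous.aestronglyMeasurable)
      (fun n => (k0 n).1.continuous.aestronglyMeasurable) (fun n x => rfl) h1 k1
  · exact tendsto_lin a (fun n => (continuous_dir (h0 n).1 _).aestronglyMeasurable)
      (fun n => (continuous_dir (k0 n).1 _).aestronglyMeasurable) (fun n x => d n x _) h2 k2
  · exact tendsto_lin a (fun n => (continuous_dir (h0 n).1 _).aestronglyMeasurable)
      (fun n => (continuous_dir (k0 n).1 _).aestronglyMeasurable) (fun n x => d n x _) h3 k3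
  · exact tendsto_lin a (fun n => ((h0 n).1.continuous.comp hc).aestronglyMeasurable)
      (fun n => ((k0 n).1.continuous.comp hc).aestronglyMeasurable) (fun n x => rfl) h4 k4

/-- The linear combination `a u + w` of two elements of `H¹(ℝ₊²)`. -/
noncomputable def H1Function.lin (a : ℂ) (u w : H1Function) : H1Function where
  toL2 := a • u.toL2 + w.toL2
  dx := a • u.dx + w.dx
  dy := a • u.dy + w.dy
  bottom := a • u.bottom + w.bottom
  left := a • u.left + w.left
  diag := a • u.diag + w.diag
  hasWeakDeriv_dx := u.hasWeakDeriv_dx.lin w.hasWeakDeriv_dx a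
  hasWeakDeriv_dy := u.hasWeakDeriv_dy.lin w.hasWeakDeriv_dy a
  hasTrace_bottom := u.hasTrace_bottom.lin (by fun_prop) w.hasTrace_bottom a
  hasTrace_left := u.hasTrace_left.lin (by fun_prop) w.hasTrace_left a
  hasTrace_diag := u.hasTrace_diag.lin (by fun_prop) w.hasTrace_diag a

lemma hasTrace_zero (c : ℝ → ℝ × ℝ) : HasTrace c 0 0 0 0 := by
  have z : ∀ {X : Type} [MeasurableSpace X] (μ : Measure X),
      eLpNorm (fun p => (0 : ℂ) - (0 : Lp ℂ 2 μ) p) 2 μ = 0 := by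
    intro X _ μ
    rw [eLpNorm_congr_ae (g := fun _ => (0 : ℂ))]
    · simp
    · filter_upwards [Lp.coeFn_zero ℂ 2 μ] with p hp
      simp only [hp, Pi.zero_apply]; ring
  refine ⟨fun _ _ => 0, fun _ => ⟨contDiff_const, HasCompactSupport.zero⟩, ?_, ?_, ?_, ?_⟩ <;>
  · simp only [fderiv_fun_const, Pi.zero_apply, zero_apply, z]
    exact tendsto_const_nhds

lemma hasWeakDeriv_zero (e : ℝ × ℝ) : HasWeakDeriv e 0 0 := by
  intro η _ _ _
  have z : ∀ θ : ℝ × ℝ → ℂ, ∫ p, (0 : L2Q) p * θ p ∂μQ = 0 := by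
    intro θ
    rw [integral_congr_ae (g := fun _ => (0 : ℂ))]
    · simp
    · filter_upwards [Lp.coeFn_zero ℂ 2 μQ] with p hp
      simp only [hp, Pi.zero_apply]; ring
  rw [z, z, neg_zero]

/-- The zero function in `H¹(ℝ₊²)`. -/
noncomputable def H1Function.zero : H1Function where
  toL2 := 0
  dx := 0
  dy := 0
  bottom := 0
  left := 0
  diag := 0
  hasWeakDeriv_dx := hasWeakDeriv_zero _
  hasWeakDeriv_dy := hasWeakDeriv_zero _
  hasTrace_bottom := hasTrace_zero _
  hasTrace_left := hasTrace_zero _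
  hasTrace_diag := hasTrace_zero _

lemma form_zero (σ α : LinfR) (v : H1Function) : form σ α v H1Function.zero = 0 := by
  have h1 : ∫ p, (conj (v.dx p) * (0 : L2Q) p + conj (v.dy p) * (0 : L2Q) p) ∂μQ = 0 := by
    refine integral_eq_zero_of_ae ?_
    filter_upwards [Lp.coeFn_zero ℂ 2 μQ] with p hp
    simp only [hp, Pi.zero_apply]; ring
  have h2 : ∫ y, (σ y : ℂ) * (conj (v.bottom y) * (0 : L2R) y
      + conj (v.left y) * (0 : L2R) y) ∂μR = 0 := by
    refine integral_eq_zero_of_ae ?_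
    filter_upwards [Lp.coeFn_zero ℂ 2 μR] with p hp
    simp only [hp, Pi.zero_apply]; ring
  have h3 : ∫ y, (α y : ℂ) * (conj (v.diag y) * (0 : L2R) y) ∂μR = 0 := by
    refine integral_eq_zero_of_ae ?_
    filter_upwards [Lp.coeFn_zero ℂ 2 μR] with p hp
    simp only [hp, Pi.zero_apply]; ring
  simp only [form, H1Function.zero, h1, h2, h3]
  simp

lemma form_lin (σ α : LinfR) (v u w : H1Function) (a : ℂ) :
    form σ α v (H1Function.lin a u w) = a * form σ α v u + form σ α v w := by
  have i1 : ∀ z : H1Function, Integrable (fun p => conj (v.dx p) * z.dx p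
      + conj (v.dy p) * z.dy p) μQ :=
    fun z => (integrable_conj_mul _ _).add (integrable_conj_mul _ _)
  have h1 : ∫ p, (conj (v.dx p) * (a • u.dx + w.dx) p + conj (v.dy p) * (a • u.dy + w.dy) p) ∂μQ
      = a * ∫ p, (conj (v.dx p) * u.dx p + conj (v.dy p) * u.dy p) ∂μQ
        + ∫ p, (conj (v.dx p) * w.dx p + conj (v.dy p) * w.dy p) ∂μQ := by
    rw [← integral_const_mul, ← integral_add ((i1 u).const_mul a) (i1 w)]
    refine integral_congr_ae ?_
    filter_upwards [Lp.coeFn_add (a • u.dx) w.dx, Lp.coeFn_smul a u.dx,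
      Lp.coeFn_add (a • u.dy) w.dy, Lp.coeFn_smul a u.dy] with p e1 e2 e3 e4
    rw [e1, e3, Pi.add_apply, Pi.add_apply, e2, e4]
    simp only [Pi.smul_apply, smul_eq_mul]
    ring
  have i2 : ∀ z : H1Function, Integrable (fun y => (σ y : ℂ) * (conj (v.bottom y) * z.bottom y
      + conj (v.left y) * z.left y)) μR := by
    intro z
    simp only [mul_add]
    exact (integrable_weight σ _ _).add (integrable_weight σ _ _)
  have h2 : ∫ y, (σ y : ℂ) * (conj (v.bottom y) * (a • u.bottom + w.bottom) y
        + conj (v.left y) * (a • u.left + w.left) y) ∂μR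
      = a * ∫ y, (σ y : ℂ) * (conj (v.bottom y) * u.bottom y + conj (v.left y) * u.left y) ∂μR
        + ∫ y, (σ y : ℂ) * (conj (v.bottom y) * w.bottom y + conj (v.left y) * w.left y) ∂μR := by
    rw [← integral_const_mul, ← integral_add ((i2 u).const_mul a) (i2 w)]
    refine integral_congr_ae ?_
    filter_upwards [Lp.coeFn_add (a • u.bottom) w.bottom, Lp.coeFn_smul a u.bottom,
      Lp.coeFn_add (a • u.left) w.left, Lp.coeFn_smul a u.left] with p e1 e2 e3 e4
    rw [e1, e3, Pi.add_apply, Pi.add_apply, e2, e4]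
    simp only [Pi.smul_apply, smul_eq_mul]
    ring
  have h3 : ∫ y, (α y : ℂ) * (conj (v.diag y) * (a • u.diag + w.diag) y) ∂μR
      = a * ∫ y, (α y : ℂ) * (conj (v.diag y) * u.diag y) ∂μR
        + ∫ y, (α y : ℂ) * (conj (v.diag y) * w.diag y) ∂μR := by
    rw [← integral_const_mul, ← integral_add ((integrable_weight α _ _).const_mul a)
      (integrable_weight α _ _)]
    refine integral_congr_ae ?_
    filter_upwards [Lp.coeFn_add (a • u.diag) w.diag, Lp.coeFn_smul a u.diag] with p e1 e2
    rw [e1, Pi.add_apply, e2]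
    simp only [Pi.smul_apply, smul_eq_mul]
    ring
  simp only [form, H1Function.lin, h1, h2, h3]
  ring

/-! ### The operator associated with the form -/

/-- The graph of the operator associated with the form: `φ` is in the domain and is mapped to `f`
iff `φ ∈ H¹(ℝ₊²)` and `q(ψ, φ) = ⟨ψ, f⟩` for all `ψ ∈ H¹(ℝ₊²)`. -/
noncomputable def operatorGraph (σ α : LinfR) : Submodule ℂ (L2Q × L2Q) where
  carrier := {p | ∃ u : H1Function, u.toL2 = p.1 ∧
    ∀ v : H1Function, form σ α v u = inner ℂ v.toL2 p.2}
  zero_mem' := ⟨H1Function.zero, rfl, fun v => by simp [form_zero]⟩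
  add_mem' := by
    rintro p q ⟨u, hu, hu'⟩ ⟨w, hw, hw'⟩
    refine ⟨H1Function.lin 1 u w, by simp [H1Function.lin, hu, hw], fun v => ?_⟩
    rw [form_lin, hu', hw', Prod.snd_add, inner_add_right, one_mul]
  smul_mem' := by
    rintro a p ⟨u, hu, hu'⟩
    refine ⟨H1Function.lin a u H1Function.zero, by simp [H1Function.lin, H1Function.zero, hu],
      fun v => ?_⟩
    rw [form_lin, hu', form_zero, Prod.smul_snd, inner_smul_right, add_zero]

/-- The operator `-Δ_{σ,α}^{d=∞}` in `L²(ℝ₊²)`, i.e. the operator associated with the form. -/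
noncomputable def robinLaplacian (σ α : LinfR) : L2Q →ₗ.[ℂ] L2Q :=
  (operatorGraph σ α).toLinearPMap

/-! ### Spectra of unbounded operators -/

section Spectrum

variable {H : Type*} [NormedAddCommGroup H] [InnerProductSpace ℂ H]

/-- The spectrum of an unbounded operator `A`: all `z ∈ ℂ` for which `A - z` does not have an
everywhere defined bounded inverse `R`. -/
def opSpectrum (A : H →ₗ.[ℂ] H) : Set ℂ :=
  {z | ¬ ∃ R : H →L[ℂ] H,
    (∀ f : H, ∃ h : R f ∈ A.domain, A ⟨R f, h⟩ - z • R f = f) ∧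
    (∀ φ : A.domain, R (A φ - z • (φ : H)) = φ)}

/-- The eigenspace `ker (A - z)`. -/
def opEigenspace (A : H →ₗ.[ℂ] H) (z : ℂ) : Submodule ℂ H :=
  (LinearMap.ker (A.toFun - z • A.domain.subtype)).map A.domain.subtype

/-- The discrete spectrum: isolated points of the spectrum that are eigenvalues of finite
multiplicity. -/
def discreteSpectrum (A : H →ₗ.[ℂ] H) : Set ℂ :=
  {z | z ∈ opSpectrum A ∧ (∀ᶠ w in 𝓝[≠] z, w ∉ opSpectrum A) ∧
    opEigenspace A z ≠ ⊥ ∧ FiniteDimensional ℂ (opEigenspace A z)}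

/-- The essential spectrum: the complement of the discrete spectrum in the spectrum. -/
def essentialSpectrum (A : H →ₗ.[ℂ] H) : Set ℂ :=
  opSpectrum A \ discreteSpectrum A

end Spectrum

end QuarterPlane

/-!
Both halves rest on realising `H¹(ℝ₊²)` as a Hilbert space `FormDomain`: the closure, in a product of
`L²` spaces, of the jets `(η, ∂ₓη, ∂_yη, traces)` of functions in `C_c^∞(ℝ²)`. The trace inequality
(`norm_traceL_sq_le`) shows that an element is determined by its bulk components, so that
`FormDomain` and `H1Function` carry the same data, and the operator is the one associated with the
bounded symmetric operator `dirichletOp - interactionOp σ α` on `FormDomain`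
(`isFormOperator_robinLaplacian`).

*The inclusion `[0,∞) ⊆ σ_ess`.* Cones are invariant under scaling, so the packets
`a(x/L) e^{ikx} b(y/L)`, with `a` supported near `1` and `b` near `3`, stay away from the boundary
and from the diagonal, where the operator is `-Δ` whatever `σ` and `α` are. Their norm grows like `L`
while `‖(-Δ - k²)φ‖` stays bounded (`exists_quasimode`), hence `k²` is in the spectrum. As all of
`[0,∞)` is in the spectrum, none of its points is isolated, so none is in the discrete spectrum.

*The inclusion `σ_ess ⊆ [0,∞)` for decaying `σ` and `α`.* For `z ∉ [0,∞)` the form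
`∫ |∇φ|² - z ∫ |φ|²` is represented by an invertible operator
(`isUnit_shiftedForm_dirichletOp`). A trace weighted by a function that vanishes at infinity is
compact (`isCompactOperator_mulL_traceV`), because on a bounded piece of the curve it is approximated
in norm by its averages over short intervals, a finite rank operator; the error is controlled by a
Poincaré type estimate, `IsTraceCurve.exists_density`. So `interactionOp σ α` is compact, and
`IsFormOperator.notMem_essentialSpectrum` applies: by the Fredholm alternative the shifted form is
invertible, which gives the resolvent, unless `z` is an eigenvalue; eigenspaces are finite dimensional,
and eigenvalues do not accumulate at `z`, since normalised eigenvectors would subconverge while being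
orthogonal in `L²`.
-/

namespace QuarterPlane

/-! ### Operators defined by a compactly perturbed form -/

section AbstractForm

variable {V H : Type*} [NormedAddCommGroup V] [InnerProductSpace ℂ V] [CompleteSpace V]
  [NormedAddCommGroup H] [InnerProductSpace ℂ H] [CompleteSpace H]

open scoped InnerProductSpace

/-- `A` is the operator in `H` associated with the form `⟪v, P u⟫_ℂ` on the form domain `V`, where
`ι : V → H` is the embedding of the form domain: `A φ = f` iff `φ = ι u` for some `u` with
`⟪v, P u⟫_ℂ = ⟪ι v, f⟫_ℂ` for all `v`. -/
def IsFormOperator (ι : V →L[ℂ] H) (P : V →L[ℂ] V) (A : H →ₗ.[ℂ] H) : Prop :=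
  ∀ φ f, (φ, f) ∈ A.graph ↔ ∃ u, ι u = φ ∧ P u = ι.adjoint f

/-- The operator on the form domain that represents the form shifted by `z`. -/
noncomputable def shiftedForm (ι : V →L[ℂ] H) (P : V →L[ℂ] V) (z : ℂ) : V →L[ℂ] V :=
  P - z • (ι.adjoint ∘L ι)

lemma shiftedForm_apply (ι : V →L[ℂ] H) (P : V →L[ℂ] V) (z : ℂ) (u : V) :
    shiftedForm ι P z u = P u - z • ι.adjoint (ι u) := by
  simp [shiftedForm]

variable {ι : V →L[ℂ] H} {P : V →L[ℂ] V} {A : H →ₗ.[ℂ] H}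

/-- An invertible shifted form yields the resolvent `ι (P - z ι*ι)⁻¹ ι*`. -/
lemma IsFormOperator.notMem_opSpectrum_of_isUnit (hA : IsFormOperator ι P A) {z : ℂ}
    (hz : IsUnit (shiftedForm ι P z)) : z ∉ opSpectrum A := by
  obtain ⟨W, hW⟩ := hz
  have hr : ∀ x, shiftedForm ι P z ((↑W⁻¹ : V →L[ℂ] V) x) = x := fun x => by
    rw [← hW, ← mul_apply_eq_comp, W.mul_inv, one_apply_eq_self]
  have hl : ∀ x, (↑W⁻¹ : V →L[ℂ] V) (shiftedForm ι P z x) = x := fun x => by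
    rw [← hW, ← mul_apply_eq_comp, W.inv_mul, one_apply_eq_self]
  simp only [opSpectrum, mem_ofPred_eq, not_not]
  refine ⟨ι ∘L (↑W⁻¹ : V →L[ℂ] V) ∘L ι.adjoint, fun f => ?_, fun φ => ?_⟩
  · set u := (↑W⁻¹ : V →L[ℂ] V) (ι.adjoint f) with hu
    have h1 : (ι u, f + z • ι u) ∈ A.graph := by
      refine (hA _ _).2 ⟨u, rfl, ?_⟩
      have := hr (ι.adjoint f)
      rw [← hu, shiftedForm_apply, sub_eq_iff_eq_add] at this
      rw [this, map_add, map_smul]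
    obtain ⟨y, hy1, hy2⟩ := (LinearPMap.mem_graph_iff A).1 h1
    have hmem : ι u ∈ A.domain := by
      have := y.2
      rwa [hy1] at this
    refine ⟨hmem, ?_⟩
    have : y = ⟨ι u, hmem⟩ := Subtype.ext hy1
    rw [this] at hy2
    change A ⟨ι u, hmem⟩ - z • ι u = f
    rw [hy2]; simp
  · obtain ⟨u, hu1, hu2⟩ := (hA _ _).1 (A.mem_graph φ)
    have : ι.adjoint (A φ - z • (φ : H)) = shiftedForm ι P z u := by
      rw [shiftedForm_apply, map_sub, map_smul, hu2, hu1]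
    simp only [ContinuousLinearMap.comp_apply]
    rw [this, hl, hu1]

lemma IsFormOperator.opEigenspace_eq (hA : IsFormOperator ι P A)
    (z : ℂ) : opEigenspace A z
      = (LinearMap.ker (shiftedForm ι P z : V →ₗ[ℂ] V)).map (ι : V →ₗ[ℂ] H) := by
  ext φ
  simp only [opEigenspace, Submodule.mem_map, LinearMap.mem_ker]
  constructor
  · rintro ⟨x, hx, rfl⟩
    obtain ⟨u, hu1, hu2⟩ := (hA _ _).1 (A.mem_graph x)
    refine ⟨u, ?_, hu1⟩
    have hx' : A x = z • (x : H) := by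
      simpa [sub_eq_zero] using hx
    simp only [ContinuousLinearMap.coe_coe]
    rw [shiftedForm_apply, hu2, hx', map_smul, hu1, sub_self]
  · rintro ⟨u, hu, rfl⟩
    simp only [ContinuousLinearMap.coe_coe] at hu ⊢
    rw [shiftedForm_apply, sub_eq_zero, ← map_smul] at hu
    obtain ⟨y, hy1, hy2⟩ := (LinearPMap.mem_graph_iff A).1 ((hA (ι u) (z • ι u)).2 ⟨u, rfl, hu⟩)
    refine ⟨y, ?_, hy1⟩
    simp only at hy1 hy2
    change A y - z • (y : H) = 0
    rw [hy2, hy1, sub_self]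

/-- A symmetric form has only real eigenvalues. -/
lemma im_eq_zero_of_mem_ker_shiftedForm (hι : Function.Injective ι)
    (hP : ∀ u v, ⟪P u, v⟫_ℂ = ⟪u, P v⟫_ℂ) {z : ℂ} {u : V} (hu : u ≠ 0)
    (h : shiftedForm ι P z u = 0) : z.im = 0 := by
  rw [shiftedForm_apply, sub_eq_zero] at h
  have h1 := hP u u
  rw [h, inner_smul_left, inner_smul_right, ContinuousLinearMap.adjoint_inner_left,
    ContinuousLinearMap.adjoint_inner_right] at h1
  have h2 : ⟪ι u, ι u⟫_ℂ ≠ 0 := by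
    rw [inner_self_ne_zero]
    exact fun h0 => hu (hι (by rw [h0, map_zero]))
  exact Complex.conj_eq_iff_im.1 (mul_right_cancel₀ h2 h1)

/-- Eigenvectors of a symmetric form for distinct eigenvalues are orthogonal. -/
lemma inner_eq_zero_of_mem_ker_shiftedForm (hι : Function.Injective ι)
    (hP : ∀ u v, ⟪P u, v⟫_ℂ = ⟪u, P v⟫_ℂ) {z w : ℂ} (hzw : z ≠ w) {u v : V}
    (hu : shiftedForm ι P z u = 0) (hv : shiftedForm ι P w v = 0) : ⟪ι u, ι v⟫_ℂ = 0 := by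
  by_cases hu0 : u = 0
  · simp [hu0]
  have hz := Complex.conj_eq_iff_im.2 (im_eq_zero_of_mem_ker_shiftedForm hι hP hu0 hu)
  rw [shiftedForm_apply, sub_eq_zero] at hu hv
  have h1 := hP u v
  rw [hu, hv, inner_smul_left, inner_smul_right, ContinuousLinearMap.adjoint_inner_left,
    ContinuousLinearMap.adjoint_inner_right, hz] at h1
  by_contra h2
  exact hzw (mul_right_cancel₀ h2 h1)

variable {G T : V →L[ℂ] V}

lemma shiftedForm_sub_apply (z : ℂ) (u : V) :
    shiftedForm ι (G - T) z u = shiftedForm ι G z u - T u := by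
  simp only [shiftedForm_apply, sub_apply]; abel

/-- The Fredholm alternative for a compact perturbation `T` of an invertible shifted form. -/
lemma isUnit_or_exists_mem_ker (hT : IsCompactOperator T) {z : ℂ}
    (hG : IsUnit (shiftedForm ι G z)) : IsUnit (shiftedForm ι (G - T) z) ∨
      ∃ u, u ≠ 0 ∧ shiftedForm ι (G - T) z u = 0 := by
  obtain ⟨Z, hZ⟩ := hG
  have hr : ∀ x, shiftedForm ι G z ((↑Z⁻¹ : V →L[ℂ] V) x) = x := fun x => by
    rw [← hZ, ← mul_apply_eq_comp, Z.mul_inv, one_apply_eq_self]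
  have hS : IsCompactOperator ((↑Z⁻¹ : V →L[ℂ] V) ∘L T) := hT.clm_comp _
  rcases hS.hasEigenvalue_or_mem_resolventSet (one_ne_zero (α := ℂ)) with h | h
  · right
    obtain ⟨u, hu⟩ := h.exists_hasEigenvector
    refine ⟨u, hu.2, ?_⟩
    have h1 : (↑Z⁻¹ : V →L[ℂ] V) (T u) = u := by simpa using hu.apply_eq_smul
    rw [shiftedForm_sub_apply, sub_eq_zero]
    conv_lhs => rw [← h1]
    exact hr _
  · left
    rw [spectrum.mem_resolventSet_iff, map_one] at h
    have : shiftedForm ι (G - T) z = Z * (1 - (↑Z⁻¹ : V →L[ℂ] V) ∘L T) := by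
      ext u
      rw [shiftedForm_sub_apply, mul_apply_eq_comp, hZ, sub_apply,
        map_sub, ContinuousLinearMap.comp_apply, hr, one_apply_eq_self]
    rw [this]
    exact Z.isUnit.mul h

lemma finiteDimensional_ker_shiftedForm (hT : IsCompactOperator T) {z : ℂ}
    (hG : IsUnit (shiftedForm ι G z)) :
    FiniteDimensional ℂ (LinearMap.ker (shiftedForm ι (G - T) z : V →ₗ[ℂ] V)) := by
  obtain ⟨Z, hZ⟩ := hG
  have hl : ∀ x, (↑Z⁻¹ : V →L[ℂ] V) (shiftedForm ι G z x) = x := fun x => by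
    rw [← hZ, ← mul_apply_eq_comp, Z.inv_mul, one_apply_eq_self]
  set K := LinearMap.ker (shiftedForm ι (G - T) z : V →ₗ[ℂ] V) with hK
  have hS : IsCompactOperator ((((↑Z⁻¹ : V →L[ℂ] V) ∘L T : V →L[ℂ] V)) : V →ₗ[ℂ] V) :=
    hT.clm_comp _
  have hfix : ∀ u ∈ K, (((↑Z⁻¹ : V →L[ℂ] V) ∘L T : V →L[ℂ] V) : V →ₗ[ℂ] V) u = u := by
    intro u hu
    rw [hK, LinearMap.mem_ker, ContinuousLinearMap.coe_coe, shiftedForm_sub_apply,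
      sub_eq_zero] at hu
    simp only [ContinuousLinearMap.coe_coe, ContinuousLinearMap.comp_apply]
    rw [← hu, hl]
  have hcl : IsClosed (K : Set V) := (shiftedForm ι (G - T) z).isClosed_ker
  have : CompleteSpace K := hcl.completeSpace_coe
  have hmem : ∀ u ∈ K, (((↑Z⁻¹ : V →L[ℂ] V) ∘L T : V →L[ℂ] V) : V →ₗ[ℂ] V) u ∈ K :=
    fun u hu => by rw [hfix u hu]; exact hu
  have hcomp := hS.restrict' hmem
  refine FiniteDimensional.of_isCompactOperator_id (𝕜 := ℂ) ?_
  have hid : (id : K → K) =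
      (((↑Z⁻¹ : V →L[ℂ] V) ∘L T : V →L[ℂ] V) : V →ₗ[ℂ] V).restrict hmem := funext fun u => Subtype.ext (hfix u u.2).symm
  rw [hid]
  exact hcomp

/-- Eigenvalues cannot accumulate at a point where the unperturbed shifted form is invertible:
normalised eigenvectors for a sequence of eigenvalues would have, by compactness of `T`, a limit
`u` with `‖u‖ = 1`, and orthogonality in `H` would force `ι u = 0`. -/
lemma eventually_ker_shiftedForm_eq_zero (hι : Function.Injective ι)
    (hP : ∀ u v, ⟪(G - T) u, v⟫_ℂ = ⟪u, (G - T) v⟫_ℂ) (hT : IsCompactOperator T) {z : ℂ}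
    (hG : IsUnit (shiftedForm ι G z)) :
    ∀ᶠ w in 𝓝[≠] z, ∀ u, shiftedForm ι (G - T) w u = 0 → u = 0 := by
  obtain ⟨Z, hZ⟩ := hG
  have hl : ∀ x, (↑Z⁻¹ : V →L[ℂ] V) (shiftedForm ι G z x) = x := fun x => by
    rw [← hZ, ← mul_apply_eq_comp, Z.inv_mul, one_apply_eq_self]
  by_contra hcon
  obtain ⟨w, hwlim, hw⟩ := exists_seq_forall_of_frequently (not_eventually.1 hcon)
  push Not at hw
  choose u₀ hu₀ hu₀' using hw
  -- normalise in the form domain, where `T` is compact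
  set u : ℕ → V := fun n => ((‖u₀ n‖ : ℂ)⁻¹) • u₀ n with hu
  have hnorm : ∀ n, ‖u n‖ = 1 := fun n => by
    have : ‖u₀ n‖ ≠ 0 := norm_ne_zero_iff.2 (hu₀' n)
    simp [hu, norm_smul, this]
  have hker : ∀ n, shiftedForm ι (G - T) (w n) (u n) = 0 := fun n => by
    simp [hu, hu₀ n]
  have hw1 : Tendsto w atTop (𝓝 z) := tendsto_nhds_of_tendsto_nhdsWithin hwlim
  have hw2 : ∀ᶠ n in atTop, w n ≠ z := by
    have := tendsto_nhdsWithin_iff.1 hwlim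
    simpa using this.2
  obtain ⟨K, hK, hK'⟩ := hT.image_closedBall_subset_compact (f := (T : V →ₗ[ℂ] V)) 1
  obtain ⟨y, -, ψ, hψ, hψy⟩ := hK.tendsto_subseq
    (fun n => hK' ⟨u n, by simp [hnorm], rfl⟩ : ∀ n, T (u n) ∈ K)
  have hu_eq : ∀ n, u n = (↑Z⁻¹ : V →L[ℂ] V)
      (T (u n) + (w n - z) • ι.adjoint (ι (u n))) := by
    intro n
    have h1 := hker n
    rw [shiftedForm_sub_apply, shiftedForm_apply, sub_eq_zero] at h1
    conv_lhs => rw [← hl (u n)]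
    congr 1
    rw [shiftedForm_apply, ← h1, sub_smul]
    abel
  have hsmall : Tendsto (fun n => (w n - z) • ι.adjoint (ι (u n))) atTop (𝓝 0) := by
    have hb : ∀ n, ‖(w n - z) • ι.adjoint (ι (u n))‖ ≤ ‖w n - z‖ * ‖ι.adjoint ∘L ι‖ := by
      intro n
      rw [norm_smul]
      have := (ι.adjoint ∘L ι).le_opNorm (u n)
      rw [hnorm, mul_one] at this
      gcongr
      exact this
    refine squeeze_zero_norm hb ?_
    have : Tendsto (fun n => ‖w n - z‖) atTop (𝓝 0) := by
      simpa using (hw1.sub_const z).norm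
    simpa using this.mul_const ‖ι.adjoint ∘L ι‖
  set x := (↑Z⁻¹ : V →L[ℂ] V) y
  have hlim : Tendsto (fun n => u (ψ n)) atTop (𝓝 x) := by
    have h1 : Tendsto (fun n => T (u (ψ n)) + (w (ψ n) - z) • ι.adjoint (ι (u (ψ n)))) atTop
        (𝓝 (y + 0)) := hψy.add (hsmall.comp hψ.tendsto_atTop)
    rw [add_zero] at h1
    have h2 := ((↑Z⁻¹ : V →L[ℂ] V).continuous.tendsto y).comp h1
    refine h2.congr fun n => ?_
    exact (hu_eq (ψ n)).symm
  have hx1 : ‖x‖ = 1 := tendsto_nhds_unique hlim.norm (by simp [hnorm])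
  have hιlim : Tendsto (fun n => ι (u (ψ n))) atTop (𝓝 (ι x)) :=
    (ι.continuous.tendsto x).comp hlim
  have horth : ∀ᶠ k in atTop, ⟪ι (u (ψ k)), ι x⟫_ℂ = 0 := by
    filter_upwards [hψ.tendsto_atTop.eventually hw2] with k hk
    have h1 : Tendsto (fun l => ⟪ι (u (ψ k)), ι (u (ψ l))⟫_ℂ) atTop (𝓝 ⟪ι (u (ψ k)), ι x⟫_ℂ) :=
      tendsto_const_nhds.inner hιlim
    refine tendsto_nhds_unique h1 (tendsto_const_nhds.congr' ?_)
    have h2 : ∀ᶠ l in atTop, w (ψ l) ≠ w (ψ k) :=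
      (hw1.comp hψ.tendsto_atTop).eventually_ne (Ne.symm hk)
    filter_upwards [h2] with l hl
    exact (inner_eq_zero_of_mem_ker_shiftedForm hι hP (Ne.symm hl) (hker _) (hker _)).symm
  have hzero : ⟪ι x, ι x⟫_ℂ = 0 := by
    refine tendsto_nhds_unique (hιlim.inner tendsto_const_nhds) (tendsto_const_nhds.congr' ?_)
    filter_upwards [horth] with k hk
    exact hk.symm
  have : x = 0 := hι (by rw [inner_self_eq_zero.1 hzero, map_zero])
  rw [this, norm_zero] at hx1
  exact zero_ne_one hx1

/-- Weyl's theorem in form version: a compact symmetric perturbation creates no essential spectrum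
at a point near which the unperturbed shifted form is invertible. -/
theorem IsFormOperator.notMem_essentialSpectrum (hA : IsFormOperator ι (G - T) A)
    (hι : Function.Injective ι) (hP : ∀ u v, ⟪(G - T) u, v⟫_ℂ = ⟪u, (G - T) v⟫_ℂ)
    (hT : IsCompactOperator T) {z : ℂ} (hG : ∀ᶠ w in 𝓝 z, IsUnit (shiftedForm ι G w)) :
    z ∉ essentialSpectrum A := by
  rintro ⟨hz, hz'⟩
  refine hz' ⟨hz, ?_, ?_, ?_⟩
  · filter_upwards [eventually_ker_shiftedForm_eq_zero hι hP hT hG.self_of_nhds,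
      hG.filter_mono nhdsWithin_le_nhds] with w hw hGw
    rcases isUnit_or_exists_mem_ker hT hGw with h | ⟨u, hu, hu'⟩
    · exact hA.notMem_opSpectrum_of_isUnit h
    · exact absurd (hw u hu') hu
  · rcases isUnit_or_exists_mem_ker hT hG.self_of_nhds with h | ⟨u, hu, hu'⟩
    · exact absurd hz (hA.notMem_opSpectrum_of_isUnit h)
    · rw [hA.opEigenspace_eq, Submodule.ne_bot_iff]
      refine ⟨ι u, ⟨u, hu', rfl⟩, fun h0 => hu (hι (by rw [h0, map_zero]))⟩
  · rw [hA.opEigenspace_eq]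
    have := finiteDimensional_ker_shiftedForm hT hG.self_of_nhds
    infer_instance

end AbstractForm

/-! ### Trace estimates for smooth functions -/

lemma enorm_add_sq_le (x y : ℂ) : ‖x + y‖ₑ ^ 2 ≤ 2 * (‖x‖ₑ ^ 2 + ‖y‖ₑ ^ 2) := by
  have h : ‖x + y‖₊ ^ 2 ≤ 2 * (‖x‖₊ ^ 2 + ‖y‖₊ ^ 2) :=
    (pow_le_pow_left₀ zero_le (nnnorm_add_le x y) 2).trans add_sq_le
  simp only [enorm_eq_nnnorm]
  exact_mod_cast h

lemma enorm_add_three_sq_le (x y z : ℂ) :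
    ‖x + y + z‖ₑ ^ 2 ≤ 3 * (‖x‖ₑ ^ 2 + ‖y‖ₑ ^ 2 + ‖z‖ₑ ^ 2) := by
  have h0 : ‖x + y + z‖ ^ 2 ≤ 3 * (‖x‖ ^ 2 + ‖y‖ ^ 2 + ‖z‖ ^ 2) := by
    have h1 : ‖x + y + z‖ ≤ ‖x‖ + ‖y‖ + ‖z‖ := norm_add₃_le
    have h2 := pow_le_pow_left₀ (norm_nonneg _) h1 2
    nlinarith [sq_nonneg (‖x‖ - ‖y‖), sq_nonneg (‖x‖ - ‖z‖), sq_nonneg (‖y‖ - ‖z‖)]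
  have h : ‖x + y + z‖₊ ^ 2 ≤ 3 * (‖x‖₊ ^ 2 + ‖y‖₊ ^ 2 + ‖z‖₊ ^ 2) := by
    rw [← NNReal.coe_le_coe]; push_cast; exact h0
  simp only [enorm_eq_nnnorm]
  exact_mod_cast h

/-- The Cauchy–Schwarz inequality against the constant function `1`. -/
lemma sq_lintegral_le {X : Type*} [MeasurableSpace X] {μ : Measure X} {f : X → ℝ≥0∞}
    (hf : AEMeasurable f μ) : (∫⁻ x, f x ∂μ) ^ 2 ≤ μ univ * ∫⁻ x, f x ^ 2 ∂μ := by
  have h := ENNReal.lintegral_mul_le_Lp_mul_Lq μ Real.HolderConjugate.two_two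
    (aemeasurable_const (b := (1 : ℝ≥0∞))) hf
  simp only [Pi.mul_apply, one_mul, ENNReal.one_rpow, lintegral_const] at h
  have h2 := pow_le_pow_left₀ zero_le h 2
  rw [mul_pow, ← ENNReal.rpow_natCast, ← ENNReal.rpow_natCast, ← ENNReal.rpow_natCast,
    ← ENNReal.rpow_mul, ← ENNReal.rpow_mul] at h2
  simpa using h2

lemma enorm_sub_sq_le_of_contDiff {f : ℝ → ℂ} (hf : ContDiff ℝ 1 f) (a b : ℝ) :
    ‖f b - f a‖ₑ ^ 2 ≤ ENNReal.ofReal |b - a| * ∫⁻ t in uIoc a b, ‖deriv f t‖ₑ ^ 2 := by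
  have hc : Continuous (deriv f) := hf.continuous_deriv le_rfl
  have h1 : ∫ t in a..b, deriv f t = f b - f a :=
    intervalIntegral.integral_deriv_eq_sub
      (fun x _ => (hf.differentiable (by simp)).differentiableAt) (hc.intervalIntegrable a b)
  have h2 : ‖f b - f a‖ₑ ≤ ∫⁻ t in uIoc a b, ‖deriv f t‖ₑ := by
    rw [← h1]
    have : ‖∫ t in a..b, deriv f t‖ₑ = ‖∫ t in uIoc a b, deriv f t‖ₑ := by
      rw [← ofReal_norm, ← ofReal_norm, intervalIntegral.norm_intervalIntegral_eq]
    rw [this]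
    exact enorm_integral_le_lintegral_enorm _
  refine (pow_le_pow_left₀ zero_le h2 2).trans ?_
  refine (sq_lintegral_le hc.enorm.measurable.aemeasurable).trans (le_of_eq ?_)
  rw [Measure.restrict_apply_univ, Real.volume_uIoc]

/-- A one-dimensional Sobolev inequality on the half-line. -/
lemma enorm_sq_le_lintegral_Ioi {f : ℝ → ℂ} (hf : ContDiff ℝ 1 f) {a : ℝ} (ha : 0 ≤ a) :
    ‖f a‖ₑ ^ 2 ≤ 2 * ∫⁻ t in Ioi 0, (‖f t‖ₑ ^ 2 + ‖deriv f t‖ₑ ^ 2) := by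
  have hc : Continuous (deriv f) := hf.continuous_deriv le_rfl
  have hm : Measurable fun t => ‖f t‖ₑ ^ 2 := (hf.continuous.enorm.measurable).pow_const 2
  set D := ∫⁻ t in Ioi 0, ‖deriv f t‖ₑ ^ 2 with hD
  have hpt : ∀ t ∈ Ioc a (a + 1), ‖f a‖ₑ ^ 2 ≤ 2 * (‖f t‖ₑ ^ 2 + D) := by
    intro t ht
    have h1 := enorm_add_sq_le (f t) (f a - f t)
    rw [add_sub_cancel] at h1
    refine h1.trans ?_
    gcongr
    refine (enorm_sub_sq_le_of_contDiff hf t a).trans ?_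
    have h2 : ENNReal.ofReal |a - t| ≤ 1 := by
      rw [ENNReal.ofReal_le_one, abs_le]
      constructor <;> linarith [ht.1, ht.2]
    calc _ ≤ 1 * D := by
          refine mul_le_mul' h2 (lintegral_mono_set fun s hs => ?_)
          rw [uIoc_comm, uIoc_of_le ht.1.le] at hs
          exact lt_of_le_of_lt ha hs.1
      _ = D := one_mul _
  have hvol : (volume.restrict (Ioc a (a + 1))) univ = 1 := by simp
  calc ‖f a‖ₑ ^ 2 = ∫⁻ _ in Ioc a (a + 1), ‖f a‖ₑ ^ 2 := by rw [lintegral_const, hvol, mul_one]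
    _ ≤ ∫⁻ t in Ioc a (a + 1), 2 * (‖f t‖ₑ ^ 2 + D) := setLIntegral_mono' measurableSet_Ioc hpt
    _ = 2 * ((∫⁻ t in Ioc a (a + 1), ‖f t‖ₑ ^ 2) + D) := by
        rw [lintegral_const_mul _ (hm.add_const _), lintegral_add_left hm, lintegral_const, hvol,
          mul_one]
    _ ≤ 2 * ((∫⁻ t in Ioi 0, ‖f t‖ₑ ^ 2) + D) := by
        gcongr
        exact fun t ht => lt_of_le_of_lt ha ht.1
    _ = _ := by rw [lintegral_add_left hm]

/-- The `H¹` energy density `|η|² + |∂ₓη|² + |∂_yη|²`. -/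
noncomputable def energyDensity (η : ℝ × ℝ → ℂ) (p : ℝ × ℝ) : ℝ≥0∞ :=
  ‖η p‖ₑ ^ 2 + ‖fderiv ℝ η p (1, 0)‖ₑ ^ 2 + ‖fderiv ℝ η p (0, 1)‖ₑ ^ 2

lemma measurable_energyDensity {η : ℝ × ℝ → ℂ} (hη : ContDiff ℝ ∞ η) :
    Measurable (energyDensity η) :=
  ((hη.continuous.enorm.measurable.pow_const 2).add
    ((continuous_dir hη _).enorm.measurable.pow_const 2)).add
    ((continuous_dir hη _).enorm.measurable.pow_const 2)

/-- A curve in the closed quarter plane along which smooth functions are controlled by a density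
`W` on `(0,∞)` whose total mass is at most the energy: pointwise, and in their oscillation on short
intervals. The first gives the trace inequality, the second the local compactness of the trace. -/
structure IsTraceCurve (c : ℝ → ℝ × ℝ) : Prop where
  continuous : Continuous c
  exists_density : ∀ η : ℝ × ℝ → ℂ, ContDiff ℝ ∞ η → ∃ W : ℝ → ℝ≥0∞, Measurable W ∧
    ∫⁻ y in Ioi 0, W y ≤ ∫⁻ p in quadrant, energyDensity η p ∧
    (∀ y > 0, ‖η (c y)‖ₑ ^ 2 ≤ 2 * W y) ∧
    ∀ p ≥ 0, ∀ δ > 0, ∀ y ∈ Ioc p (p + δ), ∀ s ∈ Ioc p (p + δ),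
      ‖η (c y) - η (c s)‖ₑ ^ 2 ≤ 3 * (ENNReal.ofReal δ * W y + ENNReal.ofReal δ * W s
        + ∫⁻ x in Ioc p (p + δ), W x)

lemma hasDerivAt_section_right {η : ℝ × ℝ → ℂ} (hη : ContDiff ℝ ∞ η) (y t : ℝ) :
    HasDerivAt (fun t => η (y, t)) (fderiv ℝ η (y, t) (0, 1)) t := by
  have h1 : HasFDerivAt η (fderiv ℝ η (y, t)) (y, t) :=
    ((hη.differentiable (by simp)) _).hasFDerivAt
  exact h1.comp_hasDerivAt t ((hasDerivAt_const t y).prodMk (hasDerivAt_id t))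

lemma hasDerivAt_section_left {η : ℝ × ℝ → ℂ} (hη : ContDiff ℝ ∞ η) (y t : ℝ) :
    HasDerivAt (fun y => η (y, t)) (fderiv ℝ η (y, t) (1, 0)) y := by
  have h1 : HasFDerivAt η (fderiv ℝ η (y, t)) (y, t) :=
    ((hη.differentiable (by simp)) _).hasFDerivAt
  exact h1.comp_hasDerivAt y ((hasDerivAt_id y).prodMk (hasDerivAt_const y t))

/-- Graphs of nonnegative `1`-Lipschitz functions are trace curves. Two points of the curve over an
interval of length `δ` are joined through a common height `t`, over which one averages. -/
lemma isTraceCurve_graph {g : ℝ → ℝ} (hg : LipschitzWith 1 g) (hg0 : ∀ y ≥ 0, 0 ≤ g y) :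
    IsTraceCurve (fun y => (y, g y)) := by
  refine ⟨continuous_id.prodMk hg.continuous, fun η hη => ?_⟩
  have hmE := measurable_energyDensity hη
  set W : ℝ → ℝ≥0∞ := fun y => ∫⁻ t in Ioi 0, energyDensity η (y, t) with hW
  have hWm : Measurable W := hmE.lintegral_prod_right'
  have hsec : ∀ y, ContDiff ℝ 1 (fun t => η (y, t)) := fun y =>
    (hη.of_le (by simp)).comp (contDiff_const.prodMk contDiff_id)
  have hsec' : ∀ t, ContDiff ℝ 1 (fun y => η (y, t)) := fun t =>
    (hη.of_le (by simp)).comp (contDiff_id.prodMk contDiff_const)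
  have hder : ∀ y t, deriv (fun t => η (y, t)) t = fderiv ℝ η (y, t) (0, 1) := fun y t =>
    (hasDerivAt_section_right hη y t).deriv
  have hder' : ∀ t y, deriv (fun y => η (y, t)) y = fderiv ℝ η (y, t) (1, 0) := fun t y =>
    (hasDerivAt_section_left hη y t).deriv
  refine ⟨W, hWm, le_of_eq ?_, fun y hy => ?_, fun p hp δ hδ y hy s hs => ?_⟩
  · rw [quadrant, Measure.volume_eq_prod, ← Measure.prod_restrict, lintegral_prod _ hmE.aemeasurable]
  · refine (enorm_sq_le_lintegral_Ioi (hsec y) (hg0 y hy.le)).trans ?_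
    refine mul_le_mul' le_rfl (lintegral_mono fun t => ?_)
    rw [hder, energyDensity]
    exact add_le_add_left le_self_add _
  · set d := ENNReal.ofReal δ with hd
    have hd0 : d ≠ 0 := by simpa [hd] using hδ
    have hdt : d ≠ ⊤ := ENNReal.ofReal_ne_top
    set q := min (g y) (g s) with hq
    have hq0 : 0 ≤ q := le_min (hg0 y (hp.le.trans hy.1.le)) (hg0 s (hp.le.trans hs.1.le))
    have hlip : |g y - g s| ≤ δ := by
      have h1 := hg.dist_le_mul y s
      rw [Real.dist_eq, Real.dist_eq, NNReal.coe_one, one_mul] at h1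
      refine h1.trans (abs_le.2 ⟨by linarith [hy.1, hs.2], by linarith [hy.2, hs.1]⟩)
    have hyq : g y ∈ Icc q (q + δ) := by
      refine ⟨min_le_left _ _, ?_⟩
      rcases min_choice (g y) (g s) with h | h <;> rw [hq, h] <;> linarith [(abs_le.1 hlip).2]
    have hsq : g s ∈ Icc q (q + δ) := by
      refine ⟨min_le_right _ _, ?_⟩
      rcases min_choice (g y) (g s) with h | h <;> rw [hq, h] <;> linarith [(abs_le.1 hlip).1]
    -- along vertical segments of the band of heights between the two points
    have hvert : ∀ x, ∀ a ∈ Icc q (q + δ), ∀ b ∈ Icc q (q + δ),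
        ‖η (x, b) - η (x, a)‖ₑ ^ 2 ≤ d * W x := by
      intro x a ha b hb
      refine (enorm_sub_sq_le_of_contDiff (hsec x) a b).trans ?_
      have h1 : ENNReal.ofReal |b - a| ≤ d := ENNReal.ofReal_le_ofReal
        (abs_le.2 ⟨by linarith [ha.2, hb.1], by linarith [ha.1, hb.2]⟩)
      refine mul_le_mul' h1 ?_
      simp only [hder]
      calc ∫⁻ t in uIoc a b, ‖fderiv ℝ η (x, t) (0, 1)‖ₑ ^ 2
          ≤ ∫⁻ t in uIoc a b, energyDensity η (x, t) :=
            lintegral_mono fun t => le_add_self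
        _ ≤ W x := lintegral_mono_set fun t ht =>
            lt_of_le_of_lt (le_min (hq0.trans ha.1) (hq0.trans hb.1)) ht.1
    -- along horizontal segments over the interval
    have hhor : ∀ t, ‖η (y, t) - η (s, t)‖ₑ ^ 2
        ≤ d * ∫⁻ x in Ioc p (p + δ), energyDensity η (x, t) := by
      intro t
      refine (enorm_sub_sq_le_of_contDiff (hsec' t) s y).trans ?_
      have h1 : ENNReal.ofReal |y - s| ≤ d := ENNReal.ofReal_le_ofReal
        (abs_le.2 ⟨by linarith [hy.1, hs.2], by linarith [hy.2, hs.1]⟩)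
      refine mul_le_mul' h1 ?_
      simp only [hder']
      calc ∫⁻ x in uIoc s y, ‖fderiv ℝ η (x, t) (1, 0)‖ₑ ^ 2
          ≤ ∫⁻ x in uIoc s y, energyDensity η (x, t) :=
            lintegral_mono fun x => le_add_self.trans le_self_add
        _ ≤ ∫⁻ x in Ioc p (p + δ), energyDensity η (x, t) := lintegral_mono_set fun x hx =>
            ⟨lt_of_le_of_lt (le_min hs.1.le hy.1.le) hx.1, hx.2.trans (max_le hs.2 hy.2)⟩
    have hpt : ∀ t ∈ Ioc q (q + δ), ‖η (y, g y) - η (s, g s)‖ₑ ^ 2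
        ≤ 3 * (d * W y + d * W s + d * ∫⁻ x in Ioc p (p + δ), energyDensity η (x, t)) := by
      intro t ht
      have ht' : t ∈ Icc q (q + δ) := Ioc_subset_Icc_self ht
      have h1 := enorm_add_three_sq_le (η (y, g y) - η (y, t)) (η (s, t) - η (s, g s))
        (η (y, t) - η (s, t))
      have h2 : η (y, g y) - η (y, t) + (η (s, t) - η (s, g s)) + (η (y, t) - η (s, t))
          = η (y, g y) - η (s, g s) := by ring
      rw [h2] at h1
      refine h1.trans ?_
      gcongr
      · exact hvert y t ht' _ hyq
      · exact hvert s _ hsq t ht'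
      · exact hhor t
    have hmI : Measurable fun t => ∫⁻ x in Ioc p (p + δ), energyDensity η (x, t) :=
      hmE.lintegral_prod_left'
    have hvol : (volume.restrict (Ioc q (q + δ))) univ = d := by simp [hd]
    have hint : d * ‖η (y, g y) - η (s, g s)‖ₑ ^ 2
        ≤ d * (3 * (d * W y + d * W s + ∫⁻ x in Ioc p (p + δ), W x)) := by
      calc d * ‖η (y, g y) - η (s, g s)‖ₑ ^ 2
          = ∫⁻ _ in Ioc q (q + δ), ‖η (y, g y) - η (s, g s)‖ₑ ^ 2 := by
            rw [lintegral_const, hvol, mul_comm]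
        _ ≤ ∫⁻ t in Ioc q (q + δ), 3 * (d * W y + d * W s
              + d * ∫⁻ x in Ioc p (p + δ), energyDensity η (x, t)) :=
            setLIntegral_mono' measurableSet_Ioc hpt
        _ = 3 * ((d * W y + d * W s) * d
              + d * ∫⁻ t in Ioc q (q + δ), ∫⁻ x in Ioc p (p + δ), energyDensity η (x, t)) := by
            rw [lintegral_const_mul _ ((hmI.const_mul d).const_add _),
              lintegral_add_left measurable_const, lintegral_const, hvol,
              lintegral_const_mul _ hmI]
        _ ≤ 3 * ((d * W y + d * W s) * d + d * ∫⁻ x in Ioc p (p + δ), W x) := by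
            refine mul_le_mul' le_rfl (add_le_add le_rfl (mul_le_mul' le_rfl ?_))
            rw [lintegral_lintegral_swap
              (f := fun t x => energyDensity η (x, t)) (hmE.comp measurable_swap).aemeasurable]
            refine lintegral_mono fun x => lintegral_mono_set ?_
            exact fun t ht => lt_of_le_of_lt hq0 ht.1
        _ = _ := by ring
    exact (ENNReal.mul_le_mul_iff_right hd0 hdt).1 hint

lemma fderiv_comp_swap {η : ℝ × ℝ → ℂ} (hη : ContDiff ℝ ∞ η) (p e : ℝ × ℝ) :
    fderiv ℝ (fun q : ℝ × ℝ => η q.swap) p e = fderiv ℝ η p.swap e.swap := by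
  have h1 : HasFDerivAt η (fderiv ℝ η p.swap) p.swap :=
    ((hη.differentiable (by simp)) _).hasFDerivAt
  have h2 : HasFDerivAt (fun q : ℝ × ℝ => q.swap)
      ((ContinuousLinearEquiv.prodComm ℝ ℝ ℝ : (ℝ × ℝ) →L[ℝ] ℝ × ℝ)) p :=
    (ContinuousLinearEquiv.prodComm ℝ ℝ ℝ : (ℝ × ℝ) →L[ℝ] ℝ × ℝ).hasFDerivAt
  have h3 : HasFDerivAt (fun q : ℝ × ℝ => η q.swap) _ p := h1.comp p h2
  rw [h3.fderiv]
  rfl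

lemma energyDensity_comp_swap {η : ℝ × ℝ → ℂ} (hη : ContDiff ℝ ∞ η) (p : ℝ × ℝ) :
    energyDensity (fun q : ℝ × ℝ => η q.swap) p = energyDensity η p.swap := by
  simp only [energyDensity, fderiv_comp_swap hη, Prod.swap_prod_mk]
  ring

lemma lintegral_quadrant_swap (f : ℝ × ℝ → ℝ≥0∞) :
    ∫⁻ p in quadrant, f p.swap = ∫⁻ p in quadrant, f p := by
  rw [quadrant, Measure.volume_eq_prod, ← Measure.prod_restrict]
  exact lintegral_prod_swap _

lemma IsTraceCurve.swap {c : ℝ → ℝ × ℝ} (hc : IsTraceCurve c) :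
    IsTraceCurve (fun y => (c y).swap) := by
  refine ⟨continuous_swap.comp hc.continuous, fun η hη => ?_⟩
  obtain ⟨W, h1, h2, h3, h4⟩ := hc.exists_density (fun q => η q.swap)
    (hη.comp (contDiff_snd.prodMk contDiff_fst))
  refine ⟨W, h1, h2.trans (le_of_eq ?_), h3, h4⟩
  simp only [energyDensity_comp_swap hη]
  exact lintegral_quadrant_swap _

lemma isTraceCurve_bottom : IsTraceCurve (fun y => (y, 0)) :=
  isTraceCurve_graph (LipschitzWith.const' 0) (fun _ _ => le_rfl)

lemma isTraceCurve_left : IsTraceCurve (fun y => (0, y)) := isTraceCurve_bottom.swap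

lemma isTraceCurve_diag : IsTraceCurve (fun y => (y, y)) :=
  isTraceCurve_graph LipschitzWith.id (fun _ h => h)

lemma IsTraceCurve.lintegral_sq_le {c : ℝ → ℝ × ℝ} (hc : IsTraceCurve c) {η : ℝ × ℝ → ℂ}
    (hη : ContDiff ℝ ∞ η) :
    ∫⁻ y in Ioi 0, ‖η (c y)‖ₑ ^ 2 ≤ 2 * ∫⁻ p in quadrant, energyDensity η p := by
  obtain ⟨W, h1, h2, h3, -⟩ := hc.exists_density η hη
  calc ∫⁻ y in Ioi 0, ‖η (c y)‖ₑ ^ 2 ≤ ∫⁻ y in Ioi 0, 2 * W y :=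
        setLIntegral_mono' measurableSet_Ioi h3
    _ = 2 * ∫⁻ y in Ioi 0, W y := lintegral_const_mul _ h1
    _ ≤ _ := by gcongr

/-- A variance bound on an interval from a bound for the oscillation. -/
lemma lintegral_sub_mean_sq_le {b : ℝ → ℂ} (hb : Continuous b) {W : ℝ → ℝ≥0∞} (hW : Measurable W)
    {p δ : ℝ} (hδ : 0 < δ) (h : ∀ y ∈ Ioc p (p + δ), ∀ s ∈ Ioc p (p + δ),
      ‖b y - b s‖ₑ ^ 2 ≤ 3 * (ENNReal.ofReal δ * W y + ENNReal.ofReal δ * W s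
        + ∫⁻ x in Ioc p (p + δ), W x)) :
    ∫⁻ y in Ioc p (p + δ), ‖b y - (δ : ℂ)⁻¹ * ∫ s in Ioc p (p + δ), b s‖ₑ ^ 2
      ≤ 9 * ENNReal.ofReal δ * ∫⁻ x in Ioc p (p + δ), W x := by
  set d := ENNReal.ofReal δ with hd
  set I := Ioc p (p + δ) with hI
  have hd0 : d ≠ 0 := by simpa [hd] using hδ
  have hdt : d ≠ ⊤ := ENNReal.ofReal_ne_top
  have hvol : (volume.restrict I) univ = d := by simp [hd, hI]
  have hbi : IntegrableOn b I := hb.integrableOn_Ioc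
  have hmean : ∀ y, b y - (δ : ℂ)⁻¹ * ∫ s in I, b s = (δ : ℂ)⁻¹ * ∫ s in I, (b y - b s) := by
    intro y
    have hδ' : (δ : ℂ) ≠ 0 := by exact_mod_cast hδ.ne'
    rw [integral_sub (integrable_const _) hbi, integral_const, measureReal_def, hvol, hd,
      ENNReal.toReal_ofReal hδ.le, Complex.real_smul]
    field_simp
  have hinv : ‖(δ : ℂ)⁻¹‖ₑ = d⁻¹ := by
    rw [enorm_inv (by exact_mod_cast hδ.ne'), ← ofReal_norm, Complex.norm_real,
      Real.norm_of_nonneg hδ.le]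
  have hpt : ∀ y ∈ I, ‖b y - (δ : ℂ)⁻¹ * ∫ s in I, b s‖ₑ ^ 2
      ≤ 3 * (d * W y + 2 * ∫⁻ x in I, W x) := by
    intro y hy
    rw [hmean, enorm_mul, mul_pow, hinv]
    calc d⁻¹ ^ 2 * ‖∫ s in I, (b y - b s)‖ₑ ^ 2
        ≤ d⁻¹ ^ 2 * (∫⁻ s in I, ‖b y - b s‖ₑ) ^ 2 := by
          gcongr; exact enorm_integral_le_lintegral_enorm _
      _ ≤ d⁻¹ ^ 2 * (d * ∫⁻ s in I, ‖b y - b s‖ₑ ^ 2) := by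
          gcongr
          refine (sq_lintegral_le ?_).trans (le_of_eq (by rw [hvol]))
          exact (continuous_const.sub hb).enorm.measurable.aemeasurable
      _ ≤ d⁻¹ ^ 2 * (d * ∫⁻ s in I, 3 * (d * W y + d * W s + ∫⁻ x in I, W x)) := by
          refine mul_le_mul' le_rfl (mul_le_mul' le_rfl ?_)
          exact setLIntegral_mono' measurableSet_Ioc (h y hy)
      _ = d⁻¹ ^ 2 * (d * (3 * (d * W y * d + d * (∫⁻ x in I, W x) + (∫⁻ x in I, W x) * d))) := by
          rw [lintegral_const_mul _ (((hW.const_mul d).const_add _).add_const _),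
            lintegral_add_left ((hW.const_mul d).const_add _), lintegral_add_left measurable_const,
            lintegral_const, lintegral_const, lintegral_const_mul _ hW, hvol]
      _ = (d⁻¹ * d) ^ 2 * (3 * (d * W y + 2 * ∫⁻ x in I, W x)) := by ring
      _ = _ := by rw [ENNReal.inv_mul_cancel hd0 hdt, one_pow, one_mul]
  calc _ ≤ ∫⁻ y in I, 3 * (d * W y + 2 * ∫⁻ x in I, W x) :=
        setLIntegral_mono' measurableSet_Ioc hpt
    _ = 3 * (d * (∫⁻ x in I, W x) + (2 * ∫⁻ x in I, W x) * d) := by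
        rw [lintegral_const_mul _ ((hW.const_mul d).add_const _),
          lintegral_add_left (hW.const_mul d), lintegral_const_mul _ hW, lintegral_const, hvol]
    _ = _ := by ring

/-! ### The form domain as a Hilbert space of jets -/

/-- The Hilbert space of tuples `(φ, φx, φy)` on the quarter plane and `(bottom, left, diag)` on the
half-line, in which the form domain is realised. -/
abbrev JetSpace : Type :=
  WithLp 2 (PiLp 2 (fun _ : Fin 3 => L2Q) × PiLp 2 (fun _ : Fin 3 => L2R))

/-- The components `φ`, `φx`, `φy` of a jet. -/
noncomputable def bulkL (i : Fin 3) : JetSpace →L[ℂ] L2Q :=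
  PiLp.proj 2 (fun _ : Fin 3 => L2Q) i ∘L WithLp.fstL 2 ℂ _ _

/-- The trace components of a jet: bottom, left and diagonal. -/
noncomputable def traceL (k : Fin 3) : JetSpace →L[ℂ] L2R :=
  PiLp.proj 2 (fun _ : Fin 3 => L2R) k ∘L WithLp.sndL 2 ℂ _ _

/-- The three curves along which traces are taken: bottom, left and diagonal. -/
def traceCurve (k : Fin 3) : ℝ → ℝ × ℝ :=
  match k with
  | 0 => fun y => (y, 0)
  | 1 => fun y => (0, y)
  | 2 => fun y => (y, y)

lemma isTraceCurve_traceCurve (k : Fin 3) : IsTraceCurve (traceCurve k) := by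
  match k with
  | 0 => exact isTraceCurve_bottom
  | 1 => exact isTraceCurve_left
  | 2 => exact isTraceCurve_diag

/-- The bulk components `η`, `∂ₓη`, `∂_yη` of the jet of a smooth function. -/
noncomputable def bulkJet (i : Fin 3) (η : ℝ × ℝ → ℂ) : ℝ × ℝ → ℂ :=
  match i with
  | 0 => η
  | 1 => fun p => fderiv ℝ η p (1, 0)
  | 2 => fun p => fderiv ℝ η p (0, 1)

lemma continuous_bulkJet (i : Fin 3) {η : ℝ × ℝ → ℂ} (hη : ContDiff ℝ ∞ η) :
    Continuous (bulkJet i η) := by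
  match i with
  | 0 => exact hη.continuous
  | 1 => exact continuous_dir hη _
  | 2 => exact continuous_dir hη _

lemma hasCompactSupport_bulkJet (i : Fin 3) {η : ℝ × ℝ → ℂ} (hη : HasCompactSupport η) :
    HasCompactSupport (bulkJet i η) := by
  match i with
  | 0 => exact hη
  | 1 => exact hη.fderiv_apply ℝ _
  | 2 => exact hη.fderiv_apply ℝ _

lemma bulkJet_lin (i : Fin 3) {η θ : ℝ × ℝ → ℂ} (hη : ContDiff ℝ ∞ η) (hθ : ContDiff ℝ ∞ θ)
    (a : ℂ) (p : ℝ × ℝ) :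
    bulkJet i (fun q => a * η q + θ q) p = a * bulkJet i η p + bulkJet i θ p := by
  have d : ∀ e, fderiv ℝ (fun q => a * η q + θ q) p e = a * fderiv ℝ η p e + fderiv ℝ θ p e := by
    intro e
    have d1 : DifferentiableAt ℝ η p := hη.differentiable (by simp) p
    have d2 : DifferentiableAt ℝ θ p := hθ.differentiable (by simp) p
    rw [fderiv_fun_add (d1.const_mul a) d2, fderiv_const_mul d1]
    simp
  match i with
  | 0 => rfl
  | 1 => exact d _
  | 2 => exact d _

/-- `x` is the jet of the function `η`. -/
def IsJet (η : ℝ × ℝ → ℂ) (x : JetSpace) : Prop :=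
  (∀ i, bulkL i x =ᵐ[μQ] bulkJet i η) ∧ ∀ k, traceL k x =ᵐ[μR] fun y => η (traceCurve k y)

lemma enorm_sq_eq_lintegral {X : Type*} [MeasurableSpace X] {μ : Measure X} (f : Lp ℂ 2 μ) :
    ‖f‖ₑ ^ 2 = ∫⁻ x, ‖f x‖ₑ ^ 2 ∂μ := by
  have h := eLpNorm_nnreal_pow_eq_lintegral (μ := μ) (f := f) (p := 2) two_ne_zero
  rw [Lp.enorm_def]
  simpa using h

lemma enorm_sq_eq_lintegral_of_ae_eq {X : Type*} [MeasurableSpace X] {μ : Measure X}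
    {f : Lp ℂ 2 μ} {g : X → ℂ} (h : f =ᵐ[μ] g) : ‖f‖ₑ ^ 2 = ∫⁻ x, ‖g x‖ₑ ^ 2 ∂μ := by
  rw [enorm_sq_eq_lintegral]
  refine lintegral_congr_ae ?_
  filter_upwards [h] with x hx
  rw [hx]

lemma memLp_two_of_lintegral_lt_top {X : Type*} [MeasurableSpace X] {μ : Measure X} {g : X → ℂ}
    (hg : AEStronglyMeasurable g μ) (h : ∫⁻ x, ‖g x‖ₑ ^ 2 ∂μ < ⊤) : MemLp g 2 μ := by
  refine ⟨hg, ?_⟩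
  have h' := eLpNorm_nnreal_pow_eq_lintegral (μ := μ) (f := g) (p := 2) two_ne_zero
  have h2 : eLpNorm g 2 μ ^ 2 < ⊤ := by
    have : eLpNorm g 2 μ ^ 2 = ∫⁻ x, ‖g x‖ₑ ^ 2 ∂μ := by simpa using h'
    rwa [this]
  exact (ENNReal.pow_lt_top_iff.1 h2).resolve_right two_ne_zero

lemma memLp_bulkJet (i : Fin 3) {η : ℝ × ℝ → ℂ} (hη : ContDiff ℝ ∞ η)
    (hc : HasCompactSupport η) : MemLp (bulkJet i η) 2 μQ :=
  (continuous_bulkJet i hη).memLp_of_hasCompactSupport (hasCompactSupport_bulkJet i hc)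

lemma lintegral_energyDensity {η : ℝ × ℝ → ℂ} (hη : ContDiff ℝ ∞ η) {f : Fin 3 → L2Q}
    (hf : ∀ i, f i =ᵐ[μQ] bulkJet i η) :
    ∫⁻ p in quadrant, energyDensity η p = ∑ i, ‖f i‖ₑ ^ 2 := by
  have m : ∀ i, Measurable fun p => ‖bulkJet i η p‖ₑ ^ 2 := fun i =>
    (continuous_bulkJet i hη).enorm.measurable.pow_const 2
  have h : ∀ p, energyDensity η p = ‖bulkJet 0 η p‖ₑ ^ 2 + ‖bulkJet 1 η p‖ₑ ^ 2
    + ‖bulkJet 2 η p‖ₑ ^ 2 := fun p => rfl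
  have m01 : Measurable fun p => ‖bulkJet 0 η p‖ₑ ^ 2 + ‖bulkJet 1 η p‖ₑ ^ 2 := (m 0).add (m 1)
  simp only [h]
  rw [lintegral_add_left m01, lintegral_add_left (m 0), Fin.sum_univ_three]
  simp only [enorm_sq_eq_lintegral_of_ae_eq (hf _)]

lemma exists_isJet {η : ℝ × ℝ → ℂ} (hη : ContDiff ℝ ∞ η) (hc : HasCompactSupport η) :
    ∃ x, IsJet η x := by
  have hb := fun i => memLp_bulkJet i hη hc
  have ht : ∀ k, MemLp (fun y => η (traceCurve k y)) 2 μR := by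
    intro k
    refine memLp_two_of_lintegral_lt_top
      (hη.continuous.comp (isTraceCurve_traceCurve k).continuous).aestronglyMeasurable ?_
    refine ((isTraceCurve_traceCurve k).lintegral_sq_le hη).trans_lt ?_
    rw [lintegral_energyDensity hη (fun i => (hb i).coeFn_toLp)]
    refine ENNReal.mul_lt_top (by simp) ?_
    refine ENNReal.sum_lt_top.2 fun i _ => ENNReal.pow_lt_top enorm_lt_top
  refine ⟨WithLp.toLp 2 (WithLp.toLp 2 fun i => (hb i).toLp, WithLp.toLp 2 fun k => (ht k).toLp),
    fun i => ?_, fun k => ?_⟩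
  · exact (hb i).coeFn_toLp
  · exact (ht k).coeFn_toLp

lemma IsJet.lin {η θ : ℝ × ℝ → ℂ} (hη : ContDiff ℝ ∞ η) (hθ : ContDiff ℝ ∞ θ) {x y : JetSpace}
    (hx : IsJet η x) (hy : IsJet θ y) (a : ℂ) : IsJet (fun q => a * η q + θ q) (a • x + y) := by
  refine ⟨fun i => ?_, fun k => ?_⟩
  · rw [map_add, map_smul]
    filter_upwards [Lp.coeFn_add (a • bulkL i x) (bulkL i y), Lp.coeFn_smul a (bulkL i x),
      hx.1 i, hy.1 i] with p e1 e2 e3 e4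
    rw [e1, Pi.add_apply, e2, Pi.smul_apply, e3, e4, smul_eq_mul, bulkJet_lin i hη hθ]
  · rw [map_add, map_smul]
    filter_upwards [Lp.coeFn_add (a • traceL k x) (traceL k y), Lp.coeFn_smul a (traceL k x),
      hx.2 k, hy.2 k] with p e1 e2 e3 e4
    rw [e1, Pi.add_apply, e2, Pi.smul_apply, e3, e4, smul_eq_mul]

lemma isJet_zero : IsJet 0 0 := by
  refine ⟨fun i => ?_, fun k => ?_⟩
  · rw [map_zero]
    filter_upwards [Lp.coeFn_zero ℂ 2 μQ] with p hp
    rw [hp]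
    match i with
    | 0 => rfl
    | 1 => simp [bulkJet]
    | 2 => simp [bulkJet]
  · rw [map_zero]
    exact Lp.coeFn_zero ℂ 2 μR

/-- The jets of restrictions of functions in `C_c^∞(ℝ²)`. -/
def smoothJets : Submodule ℂ JetSpace where
  carrier := {x | ∃ η, ContDiff ℝ ∞ η ∧ HasCompactSupport η ∧ IsJet η x}
  zero_mem' := ⟨0, contDiff_const, HasCompactSupport.zero, isJet_zero⟩
  add_mem' := by
    rintro x y ⟨η, h1, h2, h3⟩ ⟨θ, k1, k2, k3⟩
    refine ⟨fun q => 1 * η q + θ q, (contDiff_const.mul h1).add k1, h2.mul_left.add k2, ?_⟩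
    have := h3.lin h1 k1 k3 1
    rwa [one_smul] at this
  smul_mem' := by
    rintro a x ⟨η, h1, h2, h3⟩
    refine ⟨fun q => a * η q + (0 : ℝ × ℝ → ℂ) q, (contDiff_const.mul h1).add contDiff_const,
      h2.mul_left.add HasCompactSupport.zero, ?_⟩
    have := h3.lin h1 contDiff_const isJet_zero a
    rwa [add_zero] at this

/-- The form domain `H¹(ℝ₊²)`, as the closure of the jets of smooth functions. Its norm is
equivalent to the `H¹` norm by the trace inequality. -/
noncomputable def formDomain : Submodule ℂ JetSpace := smoothJets.topologicalClosure

instance : CompleteSpace formDomain :=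
  (smoothJets.isClosed_topologicalClosure).completeSpace_coe

lemma norm_sq_jet (x : JetSpace) :
    ‖x‖ ^ 2 = ∑ i, ‖bulkL i x‖ ^ 2 + ∑ k, ‖traceL k x‖ ^ 2 := by
  rw [WithLp.prod_norm_sq_eq_of_L2, PiLp.norm_sq_eq_of_L2, PiLp.norm_sq_eq_of_L2]
  rfl

/-- A closed property of jets that holds for smooth functions holds on the form domain. -/
lemma formDomain_induction {p : JetSpace → Prop} (hp : IsClosed {x | p x})
    (h : ∀ η x, ContDiff ℝ ∞ η → HasCompactSupport η → IsJet η x → p x) {x : JetSpace}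
    (hx : x ∈ formDomain) : p x := by
  have h1 : (smoothJets : Set JetSpace) ⊆ {x | p x} := by
    rintro x ⟨η, h1, h2, h3⟩
    exact h η x h1 h2 h3
  exact closure_minimal h1 hp hx

/-- The trace inequality on the form domain. -/
lemma norm_traceL_sq_le {x : JetSpace} (hx : x ∈ formDomain) (k : Fin 3) :
    ‖traceL k x‖ ^ 2 ≤ 2 * ∑ i, ‖bulkL i x‖ ^ 2 := by
  refine formDomain_induction (p := fun x => ‖traceL k x‖ ^ 2 ≤ 2 * ∑ i, ‖bulkL i x‖ ^ 2)
    (isClosed_le (by fun_prop) (by fun_prop)) (fun η x h1 h2 h3 => ?_) hx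
  have h4 := (isTraceCurve_traceCurve k).lintegral_sq_le h1
  rw [lintegral_energyDensity h1 h3.1, ← enorm_sq_eq_lintegral_of_ae_eq (h3.2 k)] at h4
  simp only [enorm_eq_nnnorm] at h4
  exact_mod_cast h4

lemma norm_sq_le_of_mem_formDomain {x : JetSpace} (hx : x ∈ formDomain) :
    ‖x‖ ^ 2 ≤ 7 * ∑ i, ‖bulkL i x‖ ^ 2 := by
  rw [norm_sq_jet, Fin.sum_univ_three (fun k => ‖traceL k x‖ ^ 2)]
  linarith [norm_traceL_sq_le hx 0, norm_traceL_sq_le hx 1, norm_traceL_sq_le hx 2]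

/-- The projection of a jet to its bulk components identifies the form domain with a closed
subspace. -/
lemma isClosedEmbedding_bulk :
    IsClosedEmbedding (WithLp.fstL 2 ℂ (PiLp 2 fun _ : Fin 3 => L2Q)
      (PiLp 2 fun _ : Fin 3 => L2R) ∘L formDomain.subtypeL) := by
  refine AntilipschitzWith.isClosedEmbedding (K := 7)
    (ContinuousLinearMap.antilipschitz_of_bound _ fun x => ?_)
    (ContinuousLinearMap.uniformContinuous _)
  have h1 := norm_sq_le_of_mem_formDomain x.2
  have h2 : ‖(WithLp.fstL 2 ℂ (PiLp 2 fun _ : Fin 3 => L2Q)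
      (PiLp 2 fun _ : Fin 3 => L2R) ∘L formDomain.subtypeL) x‖ ^ 2
        = ∑ i, ‖bulkL i x‖ ^ 2 := PiLp.norm_sq_eq_of_L2 _ _
  rw [← h2] at h1
  refine abs_le_of_sq_le_sq' ?_ (by positivity) |>.2
  rw [Submodule.coe_norm, mul_pow]
  refine h1.trans ?_
  gcongr
  norm_num

lemma tendsto_Lp_of_ae_eq {X : Type*} [MeasurableSpace X] {μ : Measure X} {f : ℕ → Lp ℂ 2 μ}
    {g : ℕ → X → ℂ} {l : Lp ℂ 2 μ} (h : ∀ n, f n =ᵐ[μ] g n) :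
    Tendsto f atTop (𝓝 l) ↔ Tendsto (fun n => eLpNorm (fun x => g n x - l x) 2 μ) atTop (𝓝 0) := by
  rw [Lp.tendsto_Lp_iff_tendsto_eLpNorm']
  refine tendsto_congr fun n => eLpNorm_congr_ae ?_
  filter_upwards [h n] with x hx
  simp [hx]

/-- A function with a trace along one of the curves comes from the form domain. -/
lemma HasTrace.exists_mem_formDomain {k : Fin 3} {φ φx φy : L2Q} {g : L2R}
    (h : HasTrace (traceCurve k) φ φx φy g) :
    ∃ x ∈ formDomain, bulkL 0 x = φ ∧ bulkL 1 x = φx ∧ bulkL 2 x = φy ∧ traceL k x = g := by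
  obtain ⟨η, h0, h1, h2, h3, h4⟩ := h
  choose x hx using fun n => exists_isJet (h0 n).1 (h0 n).2
  have hmem : ∀ n, x n ∈ formDomain := fun n =>
    smoothJets.le_topologicalClosure ⟨η n, (h0 n).1, (h0 n).2, hx n⟩
  set y : ℕ → formDomain := fun n => ⟨x n, hmem n⟩ with hy
  set w : PiLp 2 fun _ : Fin 3 => L2Q := WithLp.toLp 2 ![φ, φx, φy] with hw
  have hlim : Tendsto (fun n => (WithLp.fstL 2 ℂ (PiLp 2 fun _ : Fin 3 => L2Q)
      (PiLp 2 fun _ : Fin 3 => L2R) ∘L formDomain.subtypeL) (y n)) atTop (𝓝 w) := by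
    have hpi : Tendsto (fun n => fun i => bulkL i (x n)) atTop (𝓝 ![φ, φx, φy]) := by
      rw [tendsto_pi_nhds]
      intro i
      rw [tendsto_Lp_of_ae_eq (fun n => (hx n).1 i)]
      fin_cases i
      · exact h1
      · exact h2
      · exact h3
    exact ((PiLp.continuous_toLp 2 (fun _ : Fin 3 => L2Q)).tendsto _).comp hpi
  have hcl := isClosedEmbedding_bulk
  obtain ⟨z, hz⟩ := hcl.isClosed_range.mem_of_tendsto hlim
    (Eventually.of_forall fun n => mem_range_self _)
  have hyz : Tendsto y atTop (𝓝 z) := by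
    rw [hcl.isInducing.tendsto_nhds_iff, hz]; exact hlim
  have hb : ∀ i, bulkL i z = ![φ, φx, φy] i := fun i => by
    have := congrArg (fun v : PiLp 2 fun _ : Fin 3 => L2Q => v i) hz
    exact this
  refine ⟨z, z.2, hb 0, hb 1, hb 2, ?_⟩
  have ht : Tendsto (fun n => traceL k (x n)) atTop (𝓝 (traceL k z)) :=
    ((traceL k ∘L formDomain.subtypeL).continuous.tendsto z).comp hyz
  exact tendsto_nhds_unique ht ((tendsto_Lp_of_ae_eq (fun n => (hx n).2 k)).2 h4)

lemma eq_of_bulkL_eq {x y : JetSpace} (hx : x ∈ formDomain) (hy : y ∈ formDomain)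
    (h : ∀ i, bulkL i x = bulkL i y) : x = y := by
  have h1 := norm_sq_le_of_mem_formDomain (formDomain.sub_mem hx hy)
  simp only [map_sub, h, sub_self, norm_zero, ne_eq, OfNat.ofNat_ne_zero, not_false_eq_true,
    zero_pow, Finset.sum_const_zero, mul_zero] at h1
  have h2 : ‖x - y‖ = 0 := by nlinarith [norm_nonneg (x - y)]
  exact sub_eq_zero.1 (norm_eq_zero.1 h2)

/-- The jet `x` consists of the data of the `H¹` function `u`. -/
structure H1Function.HasJet (u : H1Function) (x : JetSpace) : Prop where
  toL2 : bulkL 0 x = u.toL2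
  dx : bulkL 1 x = u.dx
  dy : bulkL 2 x = u.dy
  bottom : traceL 0 x = u.bottom
  left : traceL 1 x = u.left
  diag : traceL 2 x = u.diag

lemma H1Function.exists_hasJet (u : H1Function) : ∃ x ∈ formDomain, u.HasJet x := by
  obtain ⟨x, hx, x0, x1, x2, x3⟩ :=
    HasTrace.exists_mem_formDomain (k := 0) u.hasTrace_bottom
  obtain ⟨y, hy, y0, y1, y2, y3⟩ :=
    HasTrace.exists_mem_formDomain (k := 1) u.hasTrace_left
  obtain ⟨z, hz, z0, z1, z2, z3⟩ :=
    HasTrace.exists_mem_formDomain (k := 2) u.hasTrace_diag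
  have hxy : x = y := eq_of_bulkL_eq hx hy fun i => by
    match i with
    | 0 => rw [x0, y0]
    | 1 => rw [x1, y1]
    | 2 => rw [x2, y2]
  have hxz : x = z := eq_of_bulkL_eq hx hz fun i => by
    match i with
    | 0 => rw [x0, z0]
    | 1 => rw [x1, z1]
    | 2 => rw [x2, z2]
  exact ⟨x, hx, x0, x1, x2, x3, hxy ▸ y3, hxz ▸ z3⟩

lemma integral_mul_eq_inner {X : Type*} [MeasurableSpace X] {μ : Measure X} {θ : X → ℂ}
    (h : MemLp (fun p => conj (θ p)) 2 μ) (f : Lp ℂ 2 μ) :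
    ∫ p, f p * θ p ∂μ = inner ℂ h.toLp f := by
  rw [L2.inner_def]
  refine integral_congr_ae ?_
  filter_upwards [h.coeFn_toLp] with p hp
  rw [hp]
  simp

lemma memLp_conj_test {θ : ℝ × ℝ → ℂ} (hθ : Continuous θ) (hc : HasCompactSupport θ) :
    MemLp (fun p => conj (θ p)) 2 μQ :=
  (Complex.continuous_conj.comp hθ).memLp_of_hasCompactSupport (hc.comp_left (map_zero _))

lemma isClosed_hasWeakDeriv (e : ℝ × ℝ) (i : Fin 3) :
    IsClosed {x : JetSpace | HasWeakDeriv e (bulkL 0 x) (bulkL i x)} := by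
  simp only [HasWeakDeriv, ofPred_forall]
  refine isClosed_iInter fun η => isClosed_iInter fun h1 => isClosed_iInter fun h2 =>
    isClosed_iInter fun _ => ?_
  simp only [integral_mul_eq_inner (memLp_conj_test (continuous_dir h1 e) (h2.fderiv_apply ℝ e)),
    integral_mul_eq_inner (memLp_conj_test h1.continuous h2)]
  exact isClosed_eq (by fun_prop) (by fun_prop)

lemma setIntegral_quadrant_mul {f η : ℝ × ℝ → ℂ} (hs : tsupport η ⊆ quadrant) :
    ∫ p in quadrant, f p * η p = ∫ p, f p * η p := by
  refine setIntegral_eq_integral_of_forall_compl_eq_zero fun p hp => ?_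
  rw [image_eq_zero_of_notMem_tsupport fun h => hp (hs h), mul_zero]

lemma hasWeakDeriv_of_contDiff {ζ : ℝ × ℝ → ℂ} (hζ : ContDiff ℝ ∞ ζ) (e : ℝ × ℝ) {φ g : L2Q}
    (hφ : φ =ᵐ[μQ] ζ) (hg : g =ᵐ[μQ] fun p => fderiv ℝ ζ p e) : HasWeakDeriv e φ g := by
  intro η h1 h2 h3
  have hfd : HasCompactSupport fun p => fderiv ℝ η p e := h2.fderiv_apply ℝ e
  have e1 : ∫ p, φ p * fderiv ℝ η p e ∂μQ = ∫ p in quadrant, ζ p * fderiv ℝ η p e :=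
    integral_congr_ae (hφ.mono fun p hp => by simp only [hp])
  have e2 : ∫ p, g p * η p ∂μQ = ∫ p in quadrant, fderiv ℝ ζ p e * η p :=
    integral_congr_ae (hg.mono fun p hp => by simp only [hp])
  have h4 : tsupport (fun p => fderiv ℝ η p e) ⊆ quadrant :=
    (tsupport_fderiv_apply_subset ℝ e).trans h3
  rw [e1, e2, setIntegral_quadrant_mul h3, setIntegral_quadrant_mul h4]
  refine integral_mul_fderiv_eq_neg_fderiv_mul_of_integrable ?_ ?_ ?_ ?_ ?_
  · exact ((continuous_dir hζ e).mul h1.continuous).integrable_of_hasCompactSupport h2.mul_left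
  · exact (hζ.continuous.mul (continuous_dir h1 e)).integrable_of_hasCompactSupport hfd.mul_left
  · exact (hζ.continuous.mul h1.continuous).integrable_of_hasCompactSupport h2.mul_left
  · exact fun _ _ => hζ.differentiable (by simp) _
  · exact fun _ _ => h1.differentiable (by simp) _

lemma exists_h1Function {x : JetSpace} (hx : x ∈ formDomain) : ∃ u : H1Function, u.HasJet x := by
  have htr : ∀ k, HasTrace (traceCurve k) (bulkL 0 x) (bulkL 1 x) (bulkL 2 x) (traceL k x) := by
    intro k
    obtain ⟨y, hy, hyx⟩ := mem_closure_iff_seq_limit.1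
      (show x ∈ closure (smoothJets : Set JetSpace) from hx)
    choose η h1 h2 h3 using hy
    have hb : ∀ i, Tendsto (fun n => eLpNorm (fun p => bulkJet i (η n) p - bulkL i x p) 2 μQ)
        atTop (𝓝 0) := fun i =>
      (tendsto_Lp_of_ae_eq (fun n => (h3 n).1 i)).1 (((bulkL i).continuous.tendsto x).comp hyx)
    exact ⟨η, fun n => ⟨h1 n, h2 n⟩, hb 0, hb 1, hb 2,
      (tendsto_Lp_of_ae_eq (fun n => (h3 n).2 k)).1 (((traceL k).continuous.tendsto x).comp hyx)⟩
  have hdx : HasWeakDeriv (1, 0) (bulkL 0 x) (bulkL 1 x) :=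
    formDomain_induction (p := fun x => HasWeakDeriv (1, 0) (bulkL 0 x) (bulkL 1 x))
      (isClosed_hasWeakDeriv _ 1)
      (fun η x h1 h2 h3 => hasWeakDeriv_of_contDiff h1 _ (h3.1 0) (h3.1 1)) hx
  have hdy : HasWeakDeriv (0, 1) (bulkL 0 x) (bulkL 2 x) :=
    formDomain_induction (p := fun x => HasWeakDeriv (0, 1) (bulkL 0 x) (bulkL 2 x))
      (isClosed_hasWeakDeriv _ 2)
      (fun η x h1 h2 h3 => hasWeakDeriv_of_contDiff h1 _ (h3.1 0) (h3.1 2)) hx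
  exact ⟨⟨_, _, _, _, _, _, hdx, hdy, htr 0, htr 1, htr 2⟩, rfl, rfl, rfl, rfl, rfl, rfl⟩

lemma isOpen_quadrant : IsOpen quadrant := isOpen_Ioi.prod isOpen_Ioi

/-- The fundamental lemma of the calculus of variations in `L²(ℝ₊²)`. -/
lemma eq_zero_of_forall_integral_test {f : L2Q} (h : ∀ η : ℝ × ℝ → ℂ, ContDiff ℝ ∞ η →
    HasCompactSupport η → tsupport η ⊆ quadrant → ∫ p, f p * η p ∂μQ = 0) : f = 0 := by
  refine Lp.ext ?_
  have h1 : ∀ᵐ p ∂(volume : Measure (ℝ × ℝ)), p ∈ quadrant → f p = 0 := by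
    refine isOpen_quadrant.ae_eq_zero_of_integral_contDiff_smul_eq_zero ?_ fun g g1 g2 g3 => ?_
    · have h2 : LocallyIntegrable f μQ := (Lp.memLp f).locallyIntegrable (by norm_num)
      exact locallyIntegrableOn_of_locallyIntegrable_restrict h2
    · have g4 : tsupport (fun p => (g p : ℂ)) ⊆ quadrant := by
        refine (closure_mono fun p hp => ?_).trans g3
        simpa using hp
      have h3 := h (fun p => (g p : ℂ)) (Complex.ofRealCLM.contDiff.comp g1)
        (g2.comp_left Complex.ofReal_zero) g4
      rw [setIntegral_quadrant_mul g4] at h3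
      rw [← h3]
      refine integral_congr_ae (Eventually.of_forall fun p => ?_)
      simp [mul_comm]
  have h2 : ∀ᵐ p ∂μQ, f p = 0 := (ae_restrict_iff' isOpen_quadrant.measurableSet).2 h1
  filter_upwards [h2, Lp.coeFn_zero ℂ 2 μQ] with p h3 h4
  rw [h3, h4, Pi.zero_apply]

lemma HasWeakDeriv.eq_zero {e : ℝ × ℝ} {g : L2Q} (h : HasWeakDeriv e 0 g) : g = 0 := by
  refine eq_zero_of_forall_integral_test fun η h1 h2 h3 => ?_
  have h4 := h η h1 h2 h3
  have h5 : ∫ p, (0 : L2Q) p * fderiv ℝ η p e ∂μQ = 0 := by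
    refine integral_eq_zero_of_ae ?_
    filter_upwards [Lp.coeFn_zero ℂ 2 μQ] with p hp
    rw [hp]; simp
  rw [h5] at h4
  simpa using h4.symm

/-- The form domain as a Hilbert space of its own. -/
def FormDomain : Type := formDomain

noncomputable instance : NormedAddCommGroup FormDomain :=
  inferInstanceAs (NormedAddCommGroup formDomain)

noncomputable instance : InnerProductSpace ℂ FormDomain :=
  inferInstanceAs (InnerProductSpace ℂ formDomain)

instance : CompleteSpace FormDomain := inferInstanceAs (CompleteSpace formDomain)

/-- The inclusion of the form domain into the space of jets. -/
noncomputable def jetL : FormDomain →L[ℂ] JetSpace := formDomain.subtypeL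

lemma jetL_mem (x : FormDomain) : jetL x ∈ formDomain := Subtype.property x

lemma exists_jetL_eq {x : JetSpace} (hx : x ∈ formDomain) : ∃ y, jetL y = x := ⟨⟨x, hx⟩, rfl⟩

lemma norm_jetL (x : FormDomain) : ‖jetL x‖ = ‖x‖ := rfl

lemma jetL_injective : Function.Injective jetL := Subtype.val_injective

/-- The bulk components on the form domain. -/
noncomputable def bulkV (i : Fin 3) : FormDomain →L[ℂ] L2Q := bulkL i ∘L jetL

/-- The trace components on the form domain. -/
noncomputable def traceV (k : Fin 3) : FormDomain →L[ℂ] L2R := traceL k ∘L jetL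

lemma bulkV_apply (i : Fin 3) (x : FormDomain) : bulkV i x = bulkL i (jetL x) := rfl

lemma traceV_apply (k : Fin 3) (x : FormDomain) : traceV k x = traceL k (jetL x) := rfl

/-- An element of `H¹(ℝ₊²)` is determined by its values. -/
lemma bulkV_zero_injective : Function.Injective (bulkV 0) := by
  rw [injective_iff_map_eq_zero]
  intro x hx
  obtain ⟨u, hu⟩ := exists_h1Function (jetL_mem x)
  rw [bulkV_apply] at hx
  have hu0 : u.toL2 = 0 := by rw [← hu.toL2, hx]
  have h1 : u.dx = 0 := HasWeakDeriv.eq_zero (e := (1, 0)) (hu0 ▸ u.hasWeakDeriv_dx)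
  have h2 : u.dy = 0 := HasWeakDeriv.eq_zero (e := (0, 1)) (hu0 ▸ u.hasWeakDeriv_dy)
  refine jetL_injective (eq_of_bulkL_eq (jetL_mem x) (jetL_mem 0) fun i => ?_)
  rw [map_zero, map_zero]
  match i with
  | 0 => exact hx
  | 1 => rw [hu.dx, h1]
  | 2 => rw [hu.dy, h2]

/-- The form domain is dense. -/
lemma eq_zero_of_forall_inner_bulkV_eq_zero {f : L2Q} (h : ∀ x, inner ℂ (bulkV 0 x) f = 0) :
    f = 0 := by
  refine eq_zero_of_forall_integral_test fun η h1 h2 h3 => ?_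
  have hc : ContDiff ℝ ∞ fun p => conj (η p) := Complex.conjCLE.contDiff.comp h1
  have hs : HasCompactSupport fun p => conj (η p) := h2.comp_left (map_zero _)
  obtain ⟨x, hx⟩ := exists_isJet hc hs
  obtain ⟨y, hy⟩ := exists_jetL_eq (smoothJets.le_topologicalClosure ⟨_, hc, hs, hx⟩)
  rw [integral_mul_eq_inner (memLp_conj_test h1.continuous h2)]
  have h4 : (memLp_conj_test h1.continuous h2).toLp = bulkV 0 y := by
    rw [bulkV_apply, hy]
    exact Lp.ext ((memLp_conj_test h1.continuous h2).coeFn_toLp.trans (hx.1 0).symm)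
  rw [h4, h]

/-! ### The form as a bounded operator on the form domain -/

section Gram

variable {V H : Type*} [NormedAddCommGroup V] [InnerProductSpace ℂ V] [CompleteSpace V]
  [NormedAddCommGroup H] [InnerProductSpace ℂ H] [CompleteSpace H]

/-- The operator on `V` representing the form `⟪S v, M (S u)⟫`. -/
noncomputable def gramOp (S : V →L[ℂ] H) (M : H →L[ℂ] H) : V →L[ℂ] V := S.adjoint ∘L (M ∘L S)

lemma inner_gramOp (S : V →L[ℂ] H) (M : H →L[ℂ] H) (v u : V) :
    inner ℂ v (gramOp S M u) = inner ℂ (S v) (M (S u)) := by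
  simp [gramOp, ContinuousLinearMap.adjoint_inner_right]

lemma isCompactOperator_gramOp {S : V →L[ℂ] H} {M : H →L[ℂ] H}
    (h : IsCompactOperator (M ∘L S)) : IsCompactOperator (gramOp S M) :=
  h.clm_comp S.adjoint

end Gram

/-- Multiplication by a bounded real function on `L²(ℝ₊)`. -/
noncomputable def mulL (w : LinfR) : L2R →L[ℂ] L2R :=
  LinearMap.mkContinuous
    { toFun := fun f => (w • f : L2R)
      map_add' := fun f g => MeasureTheory.Lp.ext <| by
        filter_upwards [Lp.coeFn_lpSMul (r := 2) w (f + g), Lp.coeFn_lpSMul (r := 2) w f,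
          Lp.coeFn_lpSMul (r := 2) w g, Lp.coeFn_add f g,
          Lp.coeFn_add (w • f : L2R) (w • g : L2R)] with y e1 e2 e3 e4 e5
        rw [e1, e5, Pi.add_apply, e2, e3]
        simp only [Pi.smul_apply', e4, Pi.add_apply, smul_add]
      map_smul' := fun a f => MeasureTheory.Lp.ext <| by
        filter_upwards [Lp.coeFn_lpSMul (r := 2) w (a • f), Lp.coeFn_lpSMul (r := 2) w f,
          Lp.coeFn_smul a f, Lp.coeFn_smul a (w • f : L2R)] with y e1 e2 e3 e4
        rw [e1, RingHom.id_apply, e4, Pi.smul_apply, e2]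
        simp only [Pi.smul_apply', e3, Pi.smul_apply]
        exact smul_comm _ _ _ } ‖w‖ fun f => Lp.norm_smul_le w f

lemma mulL_ae_eq (w : LinfR) (f : L2R) : mulL w f =ᵐ[μR] fun y => (w y : ℂ) * f y := by
  refine (Lp.coeFn_lpSMul w f).trans (Eventually.of_forall fun y => ?_)
  simp

lemma inner_eq_integral {X : Type*} [MeasurableSpace X] {μ : Measure X} (f g : Lp ℂ 2 μ) :
    inner ℂ f g = ∫ x, conj (f x) * g x ∂μ := by
  rw [L2.inner_def]
  simp [mul_comm]

lemma inner_mulL (w : LinfR) (f g : L2R) :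
    inner ℂ f (mulL w g) = ∫ y, (w y : ℂ) * (conj (f y) * g y) ∂μR := by
  rw [inner_eq_integral]
  refine integral_congr_ae ?_
  filter_upwards [mulL_ae_eq w g] with y hy
  rw [hy]; ring

lemma inner_mulL_left (w : LinfR) (f g : L2R) :
    inner ℂ (mulL w f) g = inner ℂ f (mulL w g) := by
  rw [inner_mulL, inner_eq_integral]
  refine integral_congr_ae ?_
  filter_upwards [mulL_ae_eq w f] with y hy
  rw [hy, map_mul, Complex.conj_ofReal]; ring

/-- The operator representing the Dirichlet integral. -/
noncomputable def dirichletOp : FormDomain →L[ℂ] FormDomain :=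
  gramOp (bulkV 1) 1 + gramOp (bulkV 2) 1

/-- The operator representing the boundary and interaction terms. -/
noncomputable def interactionOp (σ α : LinfR) : FormDomain →L[ℂ] FormDomain :=
  gramOp (traceV 0) (mulL σ)
    + gramOp (traceV 1) (mulL σ)
    - gramOp (traceV 2) (mulL α)

lemma inner_dirichletOp (v u : FormDomain) : inner ℂ v (dirichletOp u)
    = inner ℂ (bulkV 1 v) (bulkV 1 u) + inner ℂ (bulkV 2 v) (bulkV 2 u) := by
  rw [dirichletOp, add_apply, inner_add_right]
  rw [inner_gramOp, inner_gramOp]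
  rfl

lemma inner_interactionOp (σ α : LinfR) (v u : FormDomain) : inner ℂ v (interactionOp σ α u)
    = inner ℂ (traceV 0 v) (mulL σ (traceV 0 u)) + inner ℂ (traceV 1 v) (mulL σ (traceV 1 u))
      - inner ℂ (traceV 2 v) (mulL α (traceV 2 u)) := by
  rw [interactionOp, sub_apply, add_apply, inner_sub_right, inner_add_right]
  rw [inner_gramOp, inner_gramOp, inner_gramOp]

lemma form_eq_inner (σ α : LinfR) {v u : H1Function} {y x : FormDomain} (hv : v.HasJet (jetL y))
    (hu : u.HasJet (jetL x)) : form σ α v u = inner ℂ y ((dirichletOp - interactionOp σ α) x) := by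
  rw [sub_apply, inner_sub_right, inner_dirichletOp, inner_interactionOp]
  simp only [bulkV_apply, traceV_apply, hu.dx, hu.dy, hv.dx, hv.dy, hu.bottom, hv.bottom, hu.left, hv.left, hu.diag,
    hv.diag, inner_mulL]
  rw [inner_eq_integral, inner_eq_integral, form,
    integral_add (integrable_conj_mul _ _) (integrable_conj_mul _ _)]
  simp only [mul_add]
  rw [integral_add (integrable_weight σ _ _) (integrable_weight σ _ _)]
  ring

lemma inner_form_symm (σ α : LinfR) (v u : FormDomain) :
    inner ℂ ((dirichletOp - interactionOp σ α) v) u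
      = inner ℂ v ((dirichletOp - interactionOp σ α) u) := by
  rw [← inner_conj_symm, sub_apply, sub_apply, inner_sub_right, inner_sub_right, map_sub,
    inner_dirichletOp, inner_interactionOp, inner_dirichletOp, inner_interactionOp]
  simp only [map_add, map_sub, inner_conj_symm, inner_mulL_left]

/-- The operator is the one associated with the form on the Hilbert space `formDomain`. -/
lemma isFormOperator_robinLaplacian (σ α : LinfR) : IsFormOperator
    (bulkV 0) (dirichletOp - interactionOp σ α) (robinLaplacian σ α) := by
  have key : ∀ φ f, (φ, f) ∈ operatorGraph σ α ↔ ∃ x : FormDomain, (bulkV 0) x = φ ∧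
      ∀ y : FormDomain, inner ℂ y ((dirichletOp - interactionOp σ α) x)
        = inner ℂ ((bulkV 0) y) f := by
    intro φ f
    constructor
    · rintro ⟨u, hu1, hu2⟩
      obtain ⟨x, hx, hux⟩ := u.exists_hasJet
      obtain ⟨x, rfl⟩ := exists_jetL_eq hx
      refine ⟨x, hux.toL2.trans hu1, fun y => ?_⟩
      obtain ⟨v, hv⟩ := exists_h1Function (jetL_mem y)
      rw [← form_eq_inner σ α hv hux, hu2, ← hv.toL2]
      rfl
    · rintro ⟨x, hx1, hx2⟩
      obtain ⟨u, hu⟩ := exists_h1Function (jetL_mem x)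
      refine ⟨u, hu.toL2.symm.trans hx1, fun v => ?_⟩
      obtain ⟨y, hy, hvy⟩ := v.exists_hasJet
      obtain ⟨y, rfl⟩ := exists_jetL_eq hy
      rw [form_eq_inner σ α hvy hu, hx2, ← hvy.toL2]
      rfl
  have hgraph : (robinLaplacian σ α).graph = operatorGraph σ α := by
    refine Submodule.toLinearPMap_graph_eq _ ?_
    rintro ⟨φ, f⟩ hp (rfl : φ = 0)
    obtain ⟨x, hx1, hx2⟩ := (key _ _).1 hp
    have hx0 : x = 0 := bulkV_zero_injective (by rw [hx1, map_zero])
    refine eq_zero_of_forall_inner_bulkV_eq_zero fun y => ?_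
    rw [← hx2, hx0, map_zero, inner_zero_right]
  intro φ f
  rw [hgraph, key]
  refine exists_congr fun x => and_congr_right fun _ => ⟨fun h => ?_, fun h y => ?_⟩
  · refine ext_inner_left ℂ fun y => ?_
    rw [h]
    exact (ContinuousLinearMap.adjoint_inner_right _ _ _).symm
  · rw [h]
    exact ContinuousLinearMap.adjoint_inner_right _ _ _

/-- Away from `[0,∞)` the numbers `a - z b` with `a, b ≥ 0` are bounded below by `a + b`. -/
lemma exists_pos_mul_add_le_norm_sub {z : ℂ} (hz : z ∉ (fun t : ℝ => (t : ℂ)) '' Ici 0) :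
    ∃ c > 0, ∀ a b : ℝ, 0 ≤ a → 0 ≤ b → c * (a + b) ≤ ‖(a : ℂ) - z * b‖ := by
  obtain ⟨d, hd, h⟩ : ∃ d > 0, ∀ a b : ℝ, 0 ≤ a → 0 ≤ b → d * b ≤ ‖(a : ℂ) - z * b‖ := by
    by_cases him : z.im = 0
    · have hre : z.re < 0 := by
        by_contra hre
        exact hz ⟨z.re, not_lt.1 hre, Complex.ext (by simp) (by simp [him])⟩
      refine ⟨-z.re, by linarith, fun a b ha hb => ?_⟩
      refine le_trans ?_ (Complex.re_le_norm _)
      simp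
      linarith
    · refine ⟨|z.im|, abs_pos.2 him, fun a b ha hb => ?_⟩
      refine le_trans (le_of_eq ?_) (Complex.abs_im_le_norm _)
      simp [abs_mul, abs_of_nonneg hb]
  set K := 1 + (‖z‖ + 1) / d with hK
  have hKpos : 0 < K := by positivity
  refine ⟨K⁻¹, inv_pos.2 hKpos, fun a b ha hb => ?_⟩
  rw [inv_mul_le_iff₀ hKpos]
  have h1 := h a b ha hb
  have h2 : a ≤ ‖(a : ℂ) - z * b‖ + ‖z‖ * b := by
    have h3 := norm_add_le ((a : ℂ) - z * b) (z * b)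
    rw [sub_add_cancel, norm_mul, Complex.norm_real, Complex.norm_real, Real.norm_of_nonneg ha,
      Real.norm_of_nonneg hb] at h3
    exact h3
  have h4 : (‖z‖ + 1) * b ≤ (‖z‖ + 1) / d * ‖(a : ℂ) - z * b‖ := by
    rw [div_mul_eq_mul_div, le_div_iff₀ hd]
    nlinarith [norm_nonneg z]
  rw [hK]
  linarith

/-- The Neumann form is coercive away from `[0,∞)`. -/
lemma isUnit_shiftedForm_dirichletOp {z : ℂ} (hz : z ∉ (fun t : ℝ => (t : ℂ)) '' Ici 0) :
    IsUnit (shiftedForm (bulkV 0) dirichletOp z) := by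
  obtain ⟨c, hc, h⟩ := exists_pos_mul_add_le_norm_sub hz
  refine ContinuousLinearMap.isUnit_of_forall_le_norm_inner_map _
    (c := Real.toNNReal (c / 7)) (Real.toNNReal_pos.2 (by positivity)) fun x => ?_
  have h1 : inner ℂ x (shiftedForm (bulkV 0) dirichletOp z x)
      = ((‖bulkV 1 x‖ ^ 2 + ‖bulkV 2 x‖ ^ 2 : ℝ) : ℂ) - z * ((‖bulkV 0 x‖ ^ 2 : ℝ) : ℂ) := by
    rw [shiftedForm_apply, inner_sub_right, inner_dirichletOp, inner_smul_right]
    rw [ContinuousLinearMap.adjoint_inner_right]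
    rw [inner_self_eq_norm_sq_to_K, inner_self_eq_norm_sq_to_K, inner_self_eq_norm_sq_to_K]
    push_cast
    rfl
  rw [norm_inner_symm, h1, Real.coe_toNNReal _ (by positivity)]
  have h2 := norm_sq_le_of_mem_formDomain (jetL_mem x)
  rw [Fin.sum_univ_three] at h2
  have h3 := h (‖bulkV 1 x‖ ^ 2 + ‖bulkV 2 x‖ ^ 2) (‖bulkV 0 x‖ ^ 2) (by positivity) (by positivity)
  refine le_trans ?_ h3
  have h4 : ‖x‖ ^ 2 ≤ 7 * (‖bulkV 0 x‖ ^ 2 + ‖bulkV 1 x‖ ^ 2 + ‖bulkV 2 x‖ ^ 2) := h2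
  nlinarith

lemma isClosed_image_ofReal_Ici : IsClosed ((fun t : ℝ => (t : ℂ)) '' Ici 0) :=
  Complex.isometry_ofReal.isClosedEmbedding.isClosedMap _ isClosed_Ici

/-- Boundary and interaction terms that are form compact add nothing to the essential spectrum
`[0,∞)` of the Neumann Laplacian. -/
lemma essentialSpectrum_subset (σ α : LinfR) (h : IsCompactOperator (interactionOp σ α)) :
    essentialSpectrum (robinLaplacian σ α) ⊆ (fun t : ℝ => (t : ℂ)) '' Ici 0 := by
  intro z hz
  by_contra hz'
  refine (isFormOperator_robinLaplacian σ α).notMem_essentialSpectrum bulkV_zero_injective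
    (inner_form_symm σ α) h ?_ hz
  filter_upwards [isClosed_image_ofReal_Ici.isOpen_compl.mem_nhds hz'] with w hw
  exact isUnit_shiftedForm_dirichletOp hw

/-! ### Compactness of weighted traces -/

/-- The `j`-th interval of length `δ` of the half-line. -/
def cell (δ : ℝ) (j : ℕ) : Set ℝ := Ioc (j * δ) (j * δ + δ)

lemma measurableSet_cell (δ : ℝ) (j : ℕ) : MeasurableSet (cell δ j) := measurableSet_Ioc

lemma cell_subset_Ioi {δ : ℝ} (hδ : 0 < δ) (j : ℕ) : cell δ j ⊆ Ioi 0 := fun _ hy =>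
  lt_of_le_of_lt (by positivity) hy.1

lemma μR_cell_ne_top (δ : ℝ) (j : ℕ) : μR (cell δ j) ≠ ⊤ :=
  ((Measure.restrict_apply_le _ _).trans_lt measure_Ioc_lt_top).ne

lemma disjoint_cell {δ : ℝ} (hδ : 0 < δ) {i j : ℕ} (h : i ≠ j) : Disjoint (cell δ i) (cell δ j) := by
  wlog hij : i < j generalizing i j
  · exact (this h.symm (lt_of_le_of_ne (not_lt.1 hij) h.symm)).symm
  refine Set.disjoint_left.2 fun y h1 h2 => ?_
  have h3 : ((i : ℝ) + 1) * δ ≤ j * δ := by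
    gcongr
    exact_mod_cast hij
  linarith [h1.2, h2.1]

lemma restrict_cell {δ : ℝ} (hδ : 0 < δ) (j : ℕ) :
    μR.restrict (cell δ j) = volume.restrict (cell δ j) :=
  Measure.restrict_restrict_of_subset (cell_subset_Ioi hδ j)

/-- The indicator function of a cell. -/
noncomputable def cellIndicator (δ : ℝ) (j : ℕ) : L2R :=
  indicatorConstLp 2 (measurableSet_cell δ j) (μR_cell_ne_top δ j) (1 : ℂ)

/-- Averaging over the first `n` cells: a finite rank operator with values in step functions. -/
noncomputable def stepAvg (δ : ℝ) (n : ℕ) : L2R →L[ℂ] L2R :=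
  ∑ j ∈ Finset.range n,
    (innerSL ℂ (cellIndicator δ j)).smulRight (((δ : ℂ)⁻¹) • cellIndicator δ j)

lemma isCompactOperator_smulRight {V W : Type*} [NormedAddCommGroup V] [NormedSpace ℂ V]
    [NormedAddCommGroup W] [NormedSpace ℂ W] (l : V →L[ℂ] ℂ) (w : W) :
    IsCompactOperator (l.smulRight w) := by
  have h1 : IsCompactOperator (ContinuousLinearMap.toSpanSingleton ℂ w : ℂ →L[ℂ] W) :=
    isCompactOperator_of_locallyCompactSpace_rng _
  exact h1.comp_clm l

lemma isCompactOperator_stepAvg (δ : ℝ) (n : ℕ) : IsCompactOperator (stepAvg δ n) := by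
  induction n with
  | zero => simpa [stepAvg] using isCompactOperator_zero
  | succ n ih =>
    have h : stepAvg δ (n + 1) = stepAvg δ n
        + (innerSL ℂ (cellIndicator δ n)).smulRight (((δ : ℂ)⁻¹) • cellIndicator δ n) :=
      Finset.sum_range_succ _ _
    rw [h]
    exact ih.add (isCompactOperator_smulRight _ _)

lemma stepAvg_ae_eq {δ : ℝ} (hδ : 0 < δ) (n : ℕ) (f : L2R) : stepAvg δ n f =ᵐ[μR] fun y =>
    ∑ j ∈ Finset.range n, (cell δ j).indicator (fun _ => (δ : ℂ)⁻¹ * ∫ s in cell δ j, f s) y := by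
  have hterm : ∀ j, (innerSL ℂ (cellIndicator δ j)).smulRight
      (((δ : ℂ)⁻¹) • cellIndicator δ j) f
      =ᵐ[μR] (cell δ j).indicator (fun _ => (δ : ℂ)⁻¹ * ∫ s in cell δ j, f s) := by
    intro j
    have h1 : inner ℂ (cellIndicator δ j) f = ∫ s in cell δ j, f s := by
      rw [cellIndicator, L2.inner_indicatorConstLp_one, restrict_cell hδ]
    rw [ContinuousLinearMap.smulRight_apply, innerSL_apply_apply, h1, smul_smul]
    have h2 : cellIndicator δ j =ᵐ[μR] (cell δ j).indicator fun _ => (1 : ℂ) :=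
      indicatorConstLp_coeFn
    filter_upwards [Lp.coeFn_smul ((∫ s in cell δ j, f s) * (δ : ℂ)⁻¹) (cellIndicator δ j), h2]
      with y e1 e2
    rw [e1, Pi.smul_apply, e2]
    by_cases hy : y ∈ cell δ j
    · simp [hy, mul_comm]
    · simp [hy]
  induction n with
  | zero =>
    simp only [stepAvg, Finset.range_zero, Finset.sum_empty, zero_apply]
    exact Lp.coeFn_zero ℂ 2 μR
  | succ n ih =>
    have h : stepAvg δ (n + 1) f = stepAvg δ n f
        + (innerSL ℂ (cellIndicator δ n)).smulRight (((δ : ℂ)⁻¹) • cellIndicator δ n) f := by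
      rw [stepAvg, Finset.sum_range_succ]; rfl
    rw [h]
    filter_upwards [Lp.coeFn_add (stepAvg δ n f)
      ((innerSL ℂ (cellIndicator δ n)).smulRight (((δ : ℂ)⁻¹) • cellIndicator δ n) f), ih,
      hterm n] with y e1 e2 e3
    rw [e1, Pi.add_apply, e2, e3, Finset.sum_range_succ]

lemma setLIntegral_Ioc_succ_cell {δ : ℝ} (hδ : 0 < δ) (n : ℕ) (F : ℝ → ℝ≥0∞) :
    ∫⁻ y in Ioc 0 ((n + 1 : ℕ) * δ), F y
      = (∫⁻ y in Ioc 0 (n * δ), F y) + ∫⁻ y in cell δ n, F y := by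
  have h1 : Ioc 0 ((n + 1 : ℕ) * δ) = Ioc 0 (n * δ) ∪ cell δ n := by
    have h2 : ((n + 1 : ℕ) : ℝ) * δ = n * δ + δ := by push_cast; ring
    rw [h2, cell, Ioc_union_Ioc_eq_Ioc (by positivity) (by linarith)]
  rw [h1, lintegral_union (measurableSet_cell δ n)]
  exact Set.disjoint_left.2 fun y h1 h2 => not_lt.2 h1.2 h2.1

/-- Up to `n δ` a trace is approximated in `L²` by its averages over cells of length `δ`. -/
lemma lintegral_sub_stepAvg_le {k : Fin 3} {η : ℝ × ℝ → ℂ} (hη : ContDiff ℝ ∞ η) {x : JetSpace}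
    (hx : IsJet η x) {δ : ℝ} (hδ : 0 < δ) (n : ℕ) :
    ∫⁻ y in Ioc 0 (n * δ), ‖traceL k x y - stepAvg δ n (traceL k x) y‖ₑ ^ 2
      ≤ 9 * ENNReal.ofReal δ * ∑ i, ‖bulkL i x‖ₑ ^ 2 := by
  obtain ⟨W, hW, hWE, -, hosc⟩ := (isTraceCurve_traceCurve k).exists_density η hη
  set b : ℝ → ℂ := fun y => η (traceCurve k y) with hb
  have hbc : Continuous b := hη.continuous.comp (isTraceCurve_traceCurve k).continuous
  have hf : ∀ᵐ y ∂volume, y ∈ Ioi (0 : ℝ) → traceL k x y = b y :=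
    (ae_restrict_iff' measurableSet_Ioi).1 (hx.2 k)
  have hs : ∀ᵐ y ∂volume, y ∈ Ioi (0 : ℝ) → stepAvg δ n (traceL k x) y
      = ∑ j ∈ Finset.range n,
        (cell δ j).indicator (fun _ => (δ : ℂ)⁻¹ * ∫ s in cell δ j, traceL k x s) y :=
    (ae_restrict_iff' measurableSet_Ioi).1 (stepAvg_ae_eq hδ n (traceL k x))
  have hmean : ∀ j, ∫ s in cell δ j, traceL k x s = ∫ s in cell δ j, b s := fun j => by
    refine setIntegral_congr_ae (measurableSet_cell δ j) ?_
    filter_upwards [hf] with y hy hyj using hy (cell_subset_Ioi hδ j hyj)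
  have hcell : ∀ i < n, ∫⁻ y in cell δ i, ‖traceL k x y - stepAvg δ n (traceL k x) y‖ₑ ^ 2
      ≤ 9 * ENNReal.ofReal δ * ∫⁻ y in cell δ i, W y := by
    intro i hi
    refine le_trans (le_of_eq ?_) (lintegral_sub_mean_sq_le hbc hW hδ
      (hosc (i * δ) (by positivity) δ hδ))
    refine setLIntegral_congr_fun_ae (measurableSet_cell δ i) ?_
    filter_upwards [hf, hs] with y h1 h2 hy
    have hy0 := cell_subset_Ioi hδ i hy
    rw [h1 hy0, h2 hy0, Finset.sum_eq_single_of_mem i (Finset.mem_range.2 hi) fun j _ hj =>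
      indicator_of_notMem (Set.disjoint_left.1 (disjoint_cell hδ hj.symm) hy) _,
      indicator_of_mem hy, hmean, cell]
  have hsum : ∀ m ≤ n, ∫⁻ y in Ioc 0 (m * δ), ‖traceL k x y - stepAvg δ n (traceL k x) y‖ₑ ^ 2
      ≤ 9 * ENNReal.ofReal δ * ∫⁻ y in Ioc 0 (m * δ), W y := by
    intro m
    induction m with
    | zero => simp
    | succ m ih =>
      intro hm
      rw [setLIntegral_Ioc_succ_cell hδ, setLIntegral_Ioc_succ_cell hδ, mul_add]
      exact add_le_add (ih (by omega)) (hcell m (by omega))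
  refine (hsum n le_rfl).trans ?_
  rw [← lintegral_energyDensity hη hx.1]
  gcongr
  exact (lintegral_mono_set Ioc_subset_Ioi_self).trans hWE

lemma enorm_sq_mul_le_of_ae_le {w : LinfR} (f : L2R) {s : Set ℝ} (hs : MeasurableSet s) {C : ℝ≥0∞}
    (h : ∀ᵐ y ∂μR, y ∈ s → ‖w y‖ₑ ≤ C) :
    ∫⁻ y in s, ‖mulL w f y‖ₑ ^ 2 ∂μR ≤ C ^ 2 * ∫⁻ y in s, ‖f y‖ₑ ^ 2 ∂μR := by
  rw [← lintegral_const_mul'' _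
    ((Lp.aestronglyMeasurable f).enorm.pow_const 2).restrict]
  refine setLIntegral_mono_ae' hs ?_
  filter_upwards [h, mulL_ae_eq w f] with y h1 h2 hy
  rw [h2, enorm_mul, mul_pow]
  gcongr
  rw [← ofReal_norm, Complex.norm_real, ofReal_norm]
  exact h1 hy

/-- The error of the step approximation of a weighted trace: the cell length `δ` controls it up to
`n δ`, the smallness of the weight beyond. -/
lemma norm_mulL_sub_stepAvg_le (w : LinfR) (k : Fin 3) {δ ε : ℝ} (hδ : 0 < δ) (hε : 0 ≤ ε) (n : ℕ)
    (h : ∀ᵐ y ∂μR, n * δ < y → ‖w y‖ ≤ ε) {x : JetSpace} (hx : x ∈ formDomain) :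
    ‖mulL w (traceL k x - stepAvg δ n (traceL k x))‖ ^ 2
      ≤ (‖w‖ ^ 2 * (9 * δ) + ε ^ 2) * ‖x‖ ^ 2 := by
  refine formDomain_induction
    (p := fun x => ‖mulL w (traceL k x - stepAvg δ n (traceL k x))‖ ^ 2
      ≤ (‖w‖ ^ 2 * (9 * δ) + ε ^ 2) * ‖x‖ ^ 2)
    (isClosed_le (by fun_prop) (by fun_prop)) (fun η x h1 h2 h3 => ?_) hx
  set f := traceL k x with hf
  set g := f - stepAvg δ n f with hg
  have hsplit : ‖mulL w g‖ₑ ^ 2 = ∫⁻ y in Ioc 0 (n * δ), ‖mulL w g y‖ₑ ^ 2 ∂μR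
      + ∫⁻ y in Ioi (n * δ), ‖mulL w g y‖ₑ ^ 2 ∂μR := by
    rw [enorm_sq_eq_lintegral, ← lintegral_union measurableSet_Ioi (Ioc_disjoint_Ioi le_rfl),
      Ioc_union_Ioi_eq_Ioi (by positivity)]
    rw [Measure.restrict_restrict measurableSet_Ioi, inter_self]
  have hgsub : g =ᵐ[μR] fun y => f y - stepAvg δ n f y := Lp.coeFn_sub _ _
  have hnear : ∫⁻ y in Ioc 0 (n * δ), ‖mulL w g y‖ₑ ^ 2 ∂μR
      ≤ ‖w‖ₑ ^ 2 * (9 * ENNReal.ofReal δ * ‖x‖ₑ ^ 2) := by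
    refine (enorm_sq_mul_le_of_ae_le (C := ‖w‖ₑ) g measurableSet_Ioc ?_).trans ?_
    · have : ∀ᵐ y ∂μR, ‖w y‖ₑ ≤ eLpNormEssSup w μR := ae_le_eLpNormEssSup
      filter_upwards [this] with y hy _
      rwa [Lp.enorm_def, eLpNorm_exponent_top]
    gcongr
    have e1 : ∫⁻ y in Ioc 0 (n * δ), ‖g y‖ₑ ^ 2 ∂μR
        = ∫⁻ y in Ioc 0 (n * δ), ‖f y - stepAvg δ n f y‖ₑ ^ 2 := by
      rw [Measure.restrict_restrict_of_subset Ioc_subset_Ioi_self]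
      refine setLIntegral_congr_fun_ae measurableSet_Ioc ?_
      filter_upwards [(ae_restrict_iff' measurableSet_Ioi).1 hgsub] with y hy hy0
      rw [hy hy0.1]
    rw [e1]
    refine (lintegral_sub_stepAvg_le h1 h3 hδ n).trans ?_
    gcongr
    have e2 : ∑ i, ‖bulkL i x‖ ^ 2 ≤ ‖x‖ ^ 2 := by
      rw [norm_sq_jet]
      exact le_add_of_nonneg_right (by positivity)
    simp only [enorm_eq_nnnorm]
    exact_mod_cast e2
  have hfar : ∫⁻ y in Ioi (n * δ), ‖mulL w g y‖ₑ ^ 2 ∂μR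
      ≤ ENNReal.ofReal ε ^ 2 * ‖x‖ₑ ^ 2 := by
    refine (enorm_sq_mul_le_of_ae_le (C := ENNReal.ofReal ε) g measurableSet_Ioi ?_).trans ?_
    · filter_upwards [h] with y hy hyn
      rw [← ofReal_norm]
      exact ENNReal.ofReal_le_ofReal (hy hyn)
    gcongr
    have e1 : ∫⁻ y in Ioi (n * δ), ‖g y‖ₑ ^ 2 ∂μR = ∫⁻ y in Ioi (n * δ), ‖f y‖ₑ ^ 2 ∂μR := by
      refine setLIntegral_congr_fun_ae measurableSet_Ioi ?_
      filter_upwards [hgsub, stepAvg_ae_eq hδ n f] with y e2 e3 hy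
      rw [e2, e3, Finset.sum_eq_zero, sub_zero]
      intro j hj
      refine indicator_of_notMem (fun hyj => ?_) _
      have e4 : ((j : ℝ) + 1) * δ ≤ n * δ := by
        gcongr
        exact_mod_cast Finset.mem_range.1 hj
      have e5 : n * δ < y := hy
      linarith [hyj.2]
    rw [e1]
    refine (setLIntegral_le_lintegral _ _).trans ?_
    rw [← enorm_sq_eq_lintegral]
    have e2 : ‖f‖ ^ 2 ≤ ‖x‖ ^ 2 := by
      rw [norm_sq_jet]
      refine le_add_of_nonneg_of_le (by positivity) ?_
      exact Finset.single_le_sum (f := fun k => ‖traceL k x‖ ^ 2) (fun _ _ => by positivity)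
        (Finset.mem_univ k)
    simp only [enorm_eq_nnnorm]
    exact_mod_cast e2
  have htot : ‖mulL w g‖ₑ ^ 2 ≤ (‖w‖ₑ ^ 2 * (9 * ENNReal.ofReal δ) + ENNReal.ofReal ε ^ 2)
      * ‖x‖ₑ ^ 2 := by
    rw [hsplit, add_mul]
    refine add_le_add (hnear.trans (le_of_eq (by ring))) hfar
  have hreal := ENNReal.toReal_mono (by finiteness) htot
  rw [ENNReal.toReal_pow, toReal_enorm, ENNReal.toReal_mul, ENNReal.toReal_pow, toReal_enorm,
    ENNReal.toReal_add (by finiteness) (by finiteness), ENNReal.toReal_mul, ENNReal.toReal_mul,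
    ENNReal.toReal_pow, ENNReal.toReal_pow, toReal_enorm, ENNReal.toReal_ofReal hδ.le,
    ENNReal.toReal_ofReal hε] at hreal
  exact hreal

/-- A trace weighted by a function that vanishes at infinity is a compact operator on the form
domain: it is the norm limit of finite rank operators. -/
lemma isCompactOperator_mulL_traceV {w : LinfR} (hw : Tendsto w (atTop ⊓ ae μR) (𝓝 0))
    (k : Fin 3) : IsCompactOperator (mulL w ∘L traceV k) := by
  have hcl := isClosed_setOfPred_isCompactOperator (σ₁₂ := RingHom.id ℂ) (M₁ := FormDomain)
    (M₂ := L2R)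
  refine hcl.closure_subset (Metric.mem_closure_iff.2 fun ε hε => ?_)
  obtain ⟨R, hR⟩ : ∃ R : ℝ, ∀ᵐ y ∂μR, R < y → ‖w y‖ ≤ ε / 2 := by
    have h1 : ∀ᶠ y in atTop ⊓ ae μR, ‖w y‖ ≤ ε / 2 := by
      filter_upwards [hw (Metric.closedBall_mem_nhds (0 : ℝ) (half_pos hε))] with y hy
      simpa using hy
    obtain ⟨s, hs, t, ht, hst⟩ := mem_inf_iff_superset.1 h1
    obtain ⟨R, hR⟩ := mem_atTop_sets.1 hs
    exact ⟨R, mem_of_superset ht fun y hy hRy => hst ⟨hR y hRy.le, hy⟩⟩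
  obtain ⟨N, hN⟩ := exists_nat_gt (max R (‖w‖ ^ 2 * 9 / (ε ^ 2 / 4)))
  have hN0 : (0 : ℝ) < N + 1 := by positivity
  set δ : ℝ := (N + 1 : ℝ)⁻¹ with hδdef
  have hδ : 0 < δ := by positivity
  set n := (N + 1) * (N + 1) with hn
  have hnδ : n * δ = N + 1 := by
    rw [hn, hδdef]; push_cast; field_simp
  have hC : ‖w‖ ^ 2 * (9 * δ) + (ε / 2) ^ 2 ≤ ε ^ 2 / 2 := by
    have h1 : ‖w‖ ^ 2 * 9 / (ε ^ 2 / 4) < N := (le_max_right _ _).trans_lt hN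
    rw [div_lt_iff₀ (by positivity)] at h1
    have h2 : ‖w‖ ^ 2 * (9 * δ) ≤ ε ^ 2 / 4 := by
      rw [hδdef, ← mul_assoc, ← div_eq_mul_inv, div_le_iff₀ hN0]
      nlinarith [sq_nonneg ε]
    nlinarith
  refine ⟨mulL w ∘L (stepAvg δ n ∘L traceV k),
    ((isCompactOperator_stepAvg δ n).comp_clm (traceV k)).clm_comp (mulL w), ?_⟩
  rw [dist_eq_norm]
  have hbound : ‖mulL w ∘L traceV k - mulL w ∘L (stepAvg δ n ∘L traceV k)‖ ≤ √(ε ^ 2 / 2) := by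
    refine ContinuousLinearMap.opNorm_le_bound _ (by positivity) fun x => ?_
    have h1 := norm_mulL_sub_stepAvg_le w k hδ (half_pos hε).le n (by
      filter_upwards [hR] with y hy hny
      refine hy ?_
      rw [hnδ] at hny
      linarith [le_max_left R (‖w‖ ^ 2 * 9 / (ε ^ 2 / 4))]) (jetL_mem x)
    rw [norm_jetL] at h1
    have h2 : ‖mulL w (traceV k x - stepAvg δ n (traceV k x))‖ ^ 2 ≤ (√(ε ^ 2 / 2) * ‖x‖) ^ 2 := by
      rw [mul_pow, Real.sq_sqrt (by positivity)]
      exact h1.trans (by gcongr)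
    have h3 := (abs_le_of_sq_le_sq' h2 (by positivity)).2
    rw [map_sub] at h3
    exact h3
  refine hbound.trans_lt ?_
  rw [Real.sqrt_lt' hε]
  nlinarith [sq_pos_of_pos hε]

lemma isCompactOperator_interactionOp {σ α : LinfR} (hσ : Tendsto σ (atTop ⊓ ae μR) (𝓝 0))
    (hα : Tendsto α (atTop ⊓ ae μR) (𝓝 0)) : IsCompactOperator (interactionOp σ α) :=
  ((isCompactOperator_gramOp (isCompactOperator_mulL_traceV hσ 0)).add
    (isCompactOperator_gramOp (isCompactOperator_mulL_traceV hσ 1))).sub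
    (isCompactOperator_gramOp (isCompactOperator_mulL_traceV hα 2))

/-! ### Wave packets away from the boundary and the diagonal -/

/-- Integration by parts of a form domain element against a test function. -/
lemma inner_bulkV_eq_neg {i : Fin 3} {e : ℝ × ℝ}
    (hi : ∀ x ∈ formDomain, HasWeakDeriv e (bulkL 0 x) (bulkL i x)) (v : FormDomain)
    {g : ℝ × ℝ → ℂ} (hg : ContDiff ℝ ∞ g) (hc : HasCompactSupport g) (hs : tsupport g ⊆ quadrant)
    {G G' : L2Q} (hG : G =ᵐ[μQ] g) (hG' : G' =ᵐ[μQ] fun p => fderiv ℝ g p e) :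
    inner ℂ (bulkV i v) G = - inner ℂ (bulkV 0 v) G' := by
  have hcg : ContDiff ℝ ∞ fun p => conj (g p) := Complex.conjCLE.contDiff.comp hg
  have hts : tsupport (fun p => conj (g p)) ⊆ quadrant :=
    (tsupport_comp_subset (map_zero _) g).trans hs
  have h1 := hi _ (jetL_mem v) (fun p => conj (g p)) hcg (hc.comp_left (map_zero _)) hts
  have hd : ∀ p, fderiv ℝ (fun p => conj (g p)) p e = conj (fderiv ℝ g p e) := by
    intro p
    have h2 : HasFDerivAt (fun p => conj (g p)) _ p :=
      (Complex.conjCLE : ℂ →L[ℝ] ℂ).hasFDerivAt.comp p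
        ((hg.differentiable (by simp)) p).hasFDerivAt
    rw [h2.fderiv]
    rfl
  simp only [hd] at h1
  rw [inner_eq_integral, inner_eq_integral]
  have e1 : ∫ p, conj (bulkV i v p) * G p ∂μQ = conj (∫ p, bulkV i v p * conj (g p) ∂μQ) := by
    rw [← integral_conj]
    refine integral_congr_ae (hG.mono fun p hp => ?_)
    simp [hp]
  have e2 : ∫ p, conj (bulkV 0 v p) * G' p ∂μQ
      = conj (∫ p, bulkV 0 v p * conj (fderiv ℝ g p e) ∂μQ) := by
    rw [← integral_conj]
    refine integral_congr_ae (hG'.mono fun p hp => ?_)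
    simp [hp]
  rw [e1, e2, bulkV_apply, bulkV_apply, h1, map_neg, neg_neg]

lemma hasWeakDeriv_dx_of_mem {x : JetSpace} (hx : x ∈ formDomain) :
    HasWeakDeriv (1, 0) (bulkL 0 x) (bulkL 1 x) := by
  obtain ⟨u, hu⟩ := exists_h1Function hx
  rw [hu.toL2, hu.dx]
  exact u.hasWeakDeriv_dx

lemma hasWeakDeriv_dy_of_mem {x : JetSpace} (hx : x ∈ formDomain) :
    HasWeakDeriv (0, 1) (bulkL 0 x) (bulkL 2 x) := by
  obtain ⟨u, hu⟩ := exists_h1Function hx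
  rw [hu.toL2, hu.dy]
  exact u.hasWeakDeriv_dy

/-- The product function `(x, y) ↦ A x * B y`. -/
def tensor (A B : ℝ → ℂ) (p : ℝ × ℝ) : ℂ := A p.1 * B p.2

lemma contDiff_tensor {A B : ℝ → ℂ} (hA : ContDiff ℝ ∞ A) (hB : ContDiff ℝ ∞ B) :
    ContDiff ℝ ∞ (tensor A B) := (hA.comp contDiff_fst).mul (hB.comp contDiff_snd)

lemma tsupport_tensor_subset (A B : ℝ → ℂ) : tsupport (tensor A B) ⊆ tsupport A ×ˢ tsupport B := by
  refine closure_minimal (fun p hp => ?_) ((isClosed_tsupport A).prod (isClosed_tsupport B))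
  have h : A p.1 * B p.2 ≠ 0 := hp
  exact ⟨subset_tsupport A (left_ne_zero_of_mul h), subset_tsupport B (right_ne_zero_of_mul h)⟩

lemma hasCompactSupport_tensor {A B : ℝ → ℂ} (hA : HasCompactSupport A)
    (hB : HasCompactSupport B) : HasCompactSupport (tensor A B) :=
  (hA.isCompact.prod hB.isCompact).of_isClosed_subset (isClosed_tsupport _)
    (tsupport_tensor_subset A B)

lemma fderiv_tensor_left {A B : ℝ → ℂ} (hA : ContDiff ℝ ∞ A) (hB : ContDiff ℝ ∞ B) (p : ℝ × ℝ) :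
    fderiv ℝ (tensor A B) p (1, 0) = tensor (deriv A) B p := by
  have h1 := hasDerivAt_section_left (contDiff_tensor hA hB) p.1 p.2
  have h2 : HasDerivAt (fun y => tensor A B (y, p.2)) (deriv A p.1 * B p.2) p.1 :=
    ((hA.differentiable (by simp)) p.1).hasDerivAt.mul_const (B p.2)
  exact h1.unique h2

lemma fderiv_tensor_right {A B : ℝ → ℂ} (hA : ContDiff ℝ ∞ A) (hB : ContDiff ℝ ∞ B) (p : ℝ × ℝ) :
    fderiv ℝ (tensor A B) p (0, 1) = tensor A (deriv B) p := by
  have h1 := hasDerivAt_section_right (contDiff_tensor hA hB) p.1 p.2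
  have h2 : HasDerivAt (fun y => tensor A B (p.1, y)) (A p.1 * deriv B p.2) p.2 :=
    ((hB.differentiable (by simp)) p.2).hasDerivAt.const_mul (A p.1)
  exact h1.unique h2

lemma contDiff_infty_deriv {A : ℝ → ℂ} (hA : ContDiff ℝ ∞ A) : ContDiff ℝ ∞ (deriv A) :=
  (contDiff_infty_iff_deriv.1 hA).2

/-- On products supported away from the boundary and the diagonal, `-Δ_{σ,α}` acts as `-Δ`. -/
lemma mem_graph_robinLaplacian_tensor (σ α : LinfR) {A B : ℝ → ℂ} (hA : ContDiff ℝ ∞ A)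
    (hB : ContDiff ℝ ∞ B) (hAc : HasCompactSupport A) (hBc : HasCompactSupport B)
    (hA0 : tsupport A ⊆ Ioi 0) (hB0 : tsupport B ⊆ Ioi 0)
    (hAB : Disjoint (tsupport A) (tsupport B)) {φ f : L2Q} (hφ : φ =ᵐ[μQ] tensor A B)
    (hf : f =ᵐ[μQ] fun p => -(tensor (deriv (deriv A)) B p + tensor A (deriv (deriv B)) p)) :
    (φ, f) ∈ (robinLaplacian σ α).graph := by
  obtain ⟨x, hx⟩ := exists_isJet (contDiff_tensor hA hB) (hasCompactSupport_tensor hAc hBc)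
  obtain ⟨u, rfl⟩ := exists_jetL_eq (smoothJets.le_topologicalClosure
    ⟨_, contDiff_tensor hA hB, hasCompactSupport_tensor hAc hBc, hx⟩)
  have hA1 : tsupport (deriv A) ⊆ tsupport A := closure_minimal (support_deriv_subset)
    (isClosed_tsupport A)
  have hB1 : tsupport (deriv B) ⊆ tsupport B := closure_minimal (support_deriv_subset)
    (isClosed_tsupport B)
  have hA1c : HasCompactSupport (deriv A) := hAc.deriv
  have hB1c : HasCompactSupport (deriv B) := hBc.deriv
  have htr : ∀ k, traceV k u = 0 := by
    intro k
    have hzero : ∀ y, tensor A B (traceCurve k y) = 0 := by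
      intro y
      by_contra hne
      have h1 : traceCurve k y ∈ tsupport A ×ˢ tsupport B :=
        tsupport_tensor_subset A B (subset_tsupport _ hne)
      match k with
      | 0 => exact lt_irrefl (0 : ℝ) (hB0 h1.2)
      | 1 => exact lt_irrefl (0 : ℝ) (hA0 h1.1)
      | 2 => exact Set.disjoint_left.1 hAB h1.1 h1.2
    refine Lp.ext ((hx.2 k).trans ?_)
    filter_upwards [Lp.coeFn_zero ℂ 2 μR] with y hy
    rw [hy, hzero, Pi.zero_apply]
  refine (isFormOperator_robinLaplacian σ α φ f).2
    ⟨u, Lp.ext ((hx.1 0).trans hφ.symm), ext_inner_left ℂ fun v => ?_⟩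
  rw [ContinuousLinearMap.adjoint_inner_right, sub_apply, inner_sub_right, inner_dirichletOp,
    inner_interactionOp]
  simp only [htr, map_zero, inner_zero_right, add_zero, sub_zero]
  have hxx := contDiff_tensor (contDiff_infty_deriv (contDiff_infty_deriv hA)) hB
  have hyy := contDiff_tensor hA (contDiff_infty_deriv (contDiff_infty_deriv hB))
  have hx2 : MemLp (tensor (deriv (deriv A)) B) 2 μQ :=
    hxx.continuous.memLp_of_hasCompactSupport (hasCompactSupport_tensor hA1c.deriv hBc)
  have hy2 : MemLp (tensor A (deriv (deriv B))) 2 μQ :=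
    hyy.continuous.memLp_of_hasCompactSupport (hasCompactSupport_tensor hAc hB1c.deriv)
  have e1 := inner_bulkV_eq_neg (i := 1) (fun _ => hasWeakDeriv_dx_of_mem) v
    (contDiff_tensor (contDiff_infty_deriv hA) hB) (hasCompactSupport_tensor hA1c hBc)
    ((tsupport_tensor_subset _ _).trans (prod_mono (hA1.trans hA0) hB0))
    (G := bulkV 1 u) (G' := hx2.toLp)
    ((hx.1 1).trans (Eventually.of_forall fun p => fderiv_tensor_left hA hB p))
    (hx2.coeFn_toLp.trans (Eventually.of_forall fun p =>
      (fderiv_tensor_left (contDiff_infty_deriv hA) hB p).symm))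
  have e2 := inner_bulkV_eq_neg (i := 2) (fun _ => hasWeakDeriv_dy_of_mem) v
    (contDiff_tensor hA (contDiff_infty_deriv hB)) (hasCompactSupport_tensor hAc hB1c)
    ((tsupport_tensor_subset _ _).trans (prod_mono hA0 (hB1.trans hB0)))
    (G := bulkV 2 u) (G' := hy2.toLp)
    ((hx.1 2).trans (Eventually.of_forall fun p => fderiv_tensor_right hA hB p))
    (hy2.coeFn_toLp.trans (Eventually.of_forall fun p =>
      (fderiv_tensor_right hA (contDiff_infty_deriv hB) p).symm))
  have e3 : f = -(hx2.toLp + hy2.toLp) := by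
    refine Lp.ext (hf.trans ?_)
    filter_upwards [Lp.coeFn_neg (hx2.toLp + hy2.toLp), Lp.coeFn_add hx2.toLp hy2.toLp,
      hx2.coeFn_toLp, hy2.coeFn_toLp] with p h1 h2 h3 h4
    rw [h1, Pi.neg_apply, h2, Pi.add_apply, h3, h4]
  rw [e1, e2, e3, inner_neg_right, inner_add_right]
  ring

/-- The one-dimensional wave packet `a(x/L) e^{ikx}`. -/
noncomputable def wavePacket (a : ℝ → ℂ) (k L : ℝ) (x : ℝ) : ℂ :=
  a (x / L) * Complex.exp (Complex.I * k * x)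

lemma contDiff_wavePacket {a : ℝ → ℂ} (ha : ContDiff ℝ ∞ a) (k L : ℝ) :
    ContDiff ℝ ∞ (wavePacket a k L) := by
  have h1 : ContDiff ℝ ∞ fun x : ℝ => x / L := contDiff_id.div_const L
  have h2 : ContDiff ℝ ∞ fun x : ℝ => Complex.exp (Complex.I * k * x) :=
    (contDiff_const.mul Complex.ofRealCLM.contDiff).cexp
  exact (ha.comp h1).mul h2

lemma norm_wavePacket (a : ℝ → ℂ) (k L x : ℝ) : ‖wavePacket a k L x‖ = ‖a (x / L)‖ := by
  have h : Complex.I * k * x = ((k * x : ℝ) : ℂ) * Complex.I := by push_cast; ring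
  rw [wavePacket, norm_mul, h, Complex.norm_exp_ofReal_mul_I, mul_one]

lemma deriv_wavePacket {a : ℝ → ℂ} (ha : ContDiff ℝ ∞ a) (k L x : ℝ) :
    deriv (wavePacket a k L) x
      = (L : ℂ)⁻¹ * wavePacket (deriv a) k L x + Complex.I * k * wavePacket a k L x := by
  have h1 : HasDerivAt (fun x : ℝ => a (x / L)) (L⁻¹ • deriv a (x / L)) x := by
    have h := HasDerivAt.scomp x ((ha.differentiable (by simp)) (x / L)).hasDerivAt
      ((hasDerivAt_id x).div_const L)
    rwa [one_div] at h
  have h2 : HasDerivAt (fun x : ℝ => Complex.exp (Complex.I * k * x))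
      (Complex.exp (Complex.I * k * x) * (Complex.I * k)) x := by
    have h := ((hasDerivAt_id x).ofReal_comp.const_mul (Complex.I * k)).cexp
    simpa using h
  have h3 : HasDerivAt (wavePacket a k L) _ x := h1.mul h2
  rw [h3.deriv]
  simp only [wavePacket, Complex.real_smul, Complex.ofReal_inv]
  ring

lemma deriv_deriv_wavePacket {a : ℝ → ℂ} (ha : ContDiff ℝ ∞ a) (k L x : ℝ) :
    deriv (deriv (wavePacket a k L)) x
      = (L : ℂ)⁻¹ ^ 2 * wavePacket (deriv (deriv a)) k L x
        + 2 * Complex.I * k * (L : ℂ)⁻¹ * wavePacket (deriv a) k L x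
        - (k : ℂ) ^ 2 * wavePacket a k L x := by
  have h1 : deriv (wavePacket a k L) = fun x => (L : ℂ)⁻¹ * wavePacket (deriv a) k L x
      + Complex.I * k * wavePacket a k L x := funext fun x => deriv_wavePacket ha k L x
  have d1 : DifferentiableAt ℝ (wavePacket (deriv a) k L) x :=
    (contDiff_wavePacket (contDiff_infty_deriv ha) k L).differentiable (by simp) x
  have d2 : DifferentiableAt ℝ (wavePacket a k L) x :=
    (contDiff_wavePacket ha k L).differentiable (by simp) x
  rw [h1, deriv_fun_add (d1.const_mul _) (d2.const_mul _), deriv_const_mul _ d1,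
    deriv_const_mul _ d2, deriv_wavePacket ha, deriv_wavePacket (contDiff_infty_deriv ha)]
  linear_combination (k : ℂ) ^ 2 * wavePacket a k L x * Complex.I_sq

lemma tsupport_wavePacket_subset {a : ℝ → ℂ} {l r L : ℝ} (hL : 0 < L) (k : ℝ)
    (h : tsupport a ⊆ Icc l r) : tsupport (wavePacket a k L) ⊆ Icc (l * L) (r * L) := by
  refine closure_minimal (fun x hx => ?_) isClosed_Icc
  have h1 : a (x / L) ≠ 0 := left_ne_zero_of_mul hx
  have h2 := h (subset_tsupport a h1)
  exact ⟨(le_div_iff₀ hL).1 h2.1, (div_le_iff₀ hL).1 h2.2⟩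

/-- There is a smooth cut-off function equal to `1` near `c` and supported near `c`, with bounded
derivatives. -/
lemma exists_cutoff (c : ℝ) : ∃ a : ℝ → ℂ, ContDiff ℝ ∞ a ∧
    tsupport a ⊆ Icc (c - 1 / 2) (c + 1 / 2) ∧ (∀ x ∈ Icc (c - 1 / 4) (c + 1 / 4), a x = 1) ∧
    (∀ x, ‖a x‖ ≤ 1) ∧ ∃ C, ∀ x, ‖deriv a x‖ ≤ C ∧ ‖deriv (deriv a) x‖ ≤ C := by
  let f : ContDiffBump c := ⟨1 / 4, 1 / 2, by norm_num, by norm_num⟩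
  have hsm : ContDiff ℝ ∞ fun x => (f x : ℂ) := Complex.ofRealCLM.contDiff.comp f.contDiff
  have hts : tsupport (fun x => (f x : ℂ)) ⊆ Icc (c - 1 / 2) (c + 1 / 2) := by
    refine (tsupport_comp_subset Complex.ofReal_zero f).trans ?_
    rw [f.tsupport_eq, Real.closedBall_eq_Icc]
  have hcs : HasCompactSupport fun x => (f x : ℂ) :=
    f.hasCompactSupport.comp_left Complex.ofReal_zero
  have hd := contDiff_infty_deriv hsm
  obtain ⟨C1, h1⟩ := hcs.deriv.exists_bound_of_continuous hd.continuous
  obtain ⟨C2, h2⟩ := hcs.deriv.deriv.exists_bound_of_continuous (contDiff_infty_deriv hd).continuous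
  refine ⟨fun x => (f x : ℂ), hsm, hts, fun x hx => ?_, fun x => ?_, max C1 C2, fun x =>
    ⟨(h1 x).trans (le_max_left _ _), (h2 x).trans (le_max_right _ _)⟩⟩
  · have h3 : x ∈ Metric.closedBall c f.rIn := by
      rw [Real.closedBall_eq_Icc]; exact hx
    simp [f.one_of_mem_closedBall h3]
  · rw [Complex.norm_real, Real.norm_of_nonneg f.nonneg]
    exact f.le_one

lemma volume_Icc_prod_Icc (a b c d : ℝ) : (volume : Measure (ℝ × ℝ)) (Icc a b ×ˢ Icc c d)
    = ENNReal.ofReal (b - a) * ENNReal.ofReal (d - c) := by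
  rw [Measure.volume_eq_prod, Measure.prod_prod, Real.volume_Icc, Real.volume_Icc]

/-- Wave packets on the length scale `L`, placed at `(L, 3L)`, are approximate eigenfunctions: their
norm grows like `L`, while the defect stays bounded. -/
lemma exists_quasimode (σ α : LinfR) (k : ℝ) : ∃ M : ℝ, ∀ L ≥ 1, ∃ φ f : L2Q,
    (φ, f) ∈ (robinLaplacian σ α).graph ∧ L / 2 ≤ ‖φ‖ ∧ ‖f - ((k ^ 2 : ℝ) : ℂ) • φ‖ ≤ M := by
  obtain ⟨a, ha, has, ha1, hal, Ca, hCa⟩ := exists_cutoff 1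
  obtain ⟨b, hb, hbs, hb1, hbl, Cb, hCb⟩ := exists_cutoff 3
  have hCa0 : 0 ≤ Ca := (norm_nonneg _).trans (hCa 0).1
  have hCb0 : 0 ≤ Cb := (norm_nonneg _).trans (hCb 0).1
  set D := Ca + 2 * |k| * Ca + Cb with hD
  refine ⟨D * 4, fun L hL => ?_⟩
  have hL0 : 0 < L := by linarith
  set A := wavePacket a k L with hAdef
  set B := wavePacket b 0 L with hBdef
  have hA : ContDiff ℝ ∞ A := contDiff_wavePacket ha k L
  have hB : ContDiff ℝ ∞ B := contDiff_wavePacket hb 0 L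
  have hAs : tsupport A ⊆ Icc ((1 - 1 / 2) * L) ((1 + 1 / 2) * L) :=
    tsupport_wavePacket_subset hL0 k has
  have hBs : tsupport B ⊆ Icc ((3 - 1 / 2) * L) ((3 + 1 / 2) * L) :=
    tsupport_wavePacket_subset hL0 0 hbs
  have hAc : HasCompactSupport A := isCompact_Icc.of_isClosed_subset (isClosed_tsupport _) hAs
  have hBc : HasCompactSupport B := isCompact_Icc.of_isClosed_subset (isClosed_tsupport _) hBs
  have hφm : MemLp (tensor A B) 2 μQ :=
    (contDiff_tensor hA hB).continuous.memLp_of_hasCompactSupport (hasCompactSupport_tensor hAc hBc)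
  have hxm : MemLp (tensor (deriv (deriv A)) B) 2 μQ :=
    (contDiff_tensor (contDiff_infty_deriv (contDiff_infty_deriv hA))
      hB).continuous.memLp_of_hasCompactSupport (hasCompactSupport_tensor hAc.deriv.deriv hBc)
  have hym : MemLp (tensor A (deriv (deriv B))) 2 μQ :=
    (contDiff_tensor hA
      (contDiff_infty_deriv (contDiff_infty_deriv hB))).continuous.memLp_of_hasCompactSupport
      (hasCompactSupport_tensor hAc hBc.deriv.deriv)
  have hfm := (hxm.add hym).neg
  refine ⟨hφm.toLp, hfm.toLp, ?_, ?_, ?_⟩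
  · refine mem_graph_robinLaplacian_tensor σ α hA hB hAc hBc (fun x hx => ?_) (fun x hx => ?_) ?_
      hφm.coeFn_toLp hfm.coeFn_toLp
    · have := (hAs hx).1
      exact lt_of_lt_of_le (by positivity) (show 1 / 2 * L ≤ x by linarith)
    · have := (hBs hx).1
      exact lt_of_lt_of_le (by positivity) (show 1 / 2 * L ≤ x by linarith)
    · refine Set.disjoint_left.2 fun x h1 h2 => ?_
      linarith [(hAs h1).2, (hBs h2).1]
  · -- the packet has modulus one on a square of side `L / 2`
    set K : Set (ℝ × ℝ) := Icc (3 / 4 * L) (5 / 4 * L) ×ˢ Icc (11 / 4 * L) (13 / 4 * L) with hK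
    have hKQ : K ⊆ quadrant := fun p hp =>
      ⟨lt_of_lt_of_le (by positivity) hp.1.1, lt_of_lt_of_le (by positivity) hp.2.1⟩
    have hKm : MeasurableSet K := measurableSet_Icc.prod measurableSet_Icc
    have hone : ∀ p ∈ K, ‖tensor A B p‖ₑ ^ 2 = 1 := by
      intro p hp
      have h1 : a (p.1 / L) = 1 := ha1 _
        ⟨by rw [le_div_iff₀ hL0]; linarith [hp.1.1], by rw [div_le_iff₀ hL0]; linarith [hp.1.2]⟩
      have h2 : b (p.2 / L) = 1 := hb1 _
        ⟨by rw [le_div_iff₀ hL0]; linarith [hp.2.1], by rw [div_le_iff₀ hL0]; linarith [hp.2.2]⟩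
      rw [← ofReal_norm, tensor, norm_mul, norm_wavePacket, norm_wavePacket, h1, h2]
      simp
    have h1 : ENNReal.ofReal (L / 2) ^ 2 ≤ ‖hφm.toLp‖ₑ ^ 2 := by
      rw [enorm_sq_eq_lintegral_of_ae_eq hφm.coeFn_toLp]
      calc ENNReal.ofReal (L / 2) ^ 2 = volume K := by
            rw [hK, volume_Icc_prod_Icc, sq]; congr 2 <;> ring
        _ = ∫⁻ p in K, ‖tensor A B p‖ₑ ^ 2 := by
            rw [setLIntegral_congr_fun hKm hone, setLIntegral_one]
        _ ≤ _ := lintegral_mono_set hKQ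
    have h2 := (ENNReal.pow_le_pow_left_iff two_ne_zero).1 h1
    rw [← ofReal_norm] at h2
    exact (ENNReal.ofReal_le_ofReal_iff (norm_nonneg _)).1 h2
  · -- the defect is of order `1 / L` on a square of side `4 L`, and vanishes outside
    set S : Set (ℝ × ℝ) := Icc 0 (4 * L) ×ˢ Icc 0 (4 * L) with hS
    set r : ℝ × ℝ → ℂ := fun p => -(tensor (deriv (deriv A)) B p + tensor A (deriv (deriv B)) p)
      - (k : ℂ) ^ 2 * tensor A B p with hr
    have hae : (hfm.toLp - ((k ^ 2 : ℝ) : ℂ) • hφm.toLp : L2Q) =ᵐ[μQ] r := by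
      filter_upwards [Lp.coeFn_sub hfm.toLp (((k ^ 2 : ℝ) : ℂ) • hφm.toLp),
        Lp.coeFn_smul ((k ^ 2 : ℝ) : ℂ) hφm.toLp, hfm.coeFn_toLp, hφm.coeFn_toLp] with p e1 e2 e3 e4
      rw [e1, Pi.sub_apply, e2, Pi.smul_apply, e3, e4, hr, smul_eq_mul, Complex.ofReal_pow]
      rfl
    have hbound : ∀ p, ‖r p‖ ≤ D / L := by
      intro p
      have h1 : r p = -(((L : ℂ)⁻¹ ^ 2 * wavePacket (deriv (deriv a)) k L p.1
          + 2 * Complex.I * k * (L : ℂ)⁻¹ * wavePacket (deriv a) k L p.1) * B p.2)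
          - A p.1 * ((L : ℂ)⁻¹ ^ 2 * wavePacket (deriv (deriv b)) 0 L p.2) := by
        simp only [hr, tensor]
        rw [hAdef, hBdef, deriv_deriv_wavePacket ha, deriv_deriv_wavePacket hb]
        push_cast
        ring
      have hLi : L⁻¹ ^ 2 ≤ L⁻¹ := by
        have h3 : L⁻¹ ≤ 1 := inv_le_one_of_one_le₀ hL
        have h4 : 0 < L⁻¹ := inv_pos.2 hL0
        nlinarith
      have hLn : ‖(L : ℂ)⁻¹‖ = L⁻¹ := by
        rw [norm_inv, Complex.norm_real, Real.norm_of_nonneg hL0.le]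
      have nA : ‖A p.1‖ ≤ 1 := by rw [hAdef, norm_wavePacket]; exact hal _
      have nB : ‖B p.2‖ ≤ 1 := by rw [hBdef, norm_wavePacket]; exact hbl _
      have n1 : ‖(L : ℂ)⁻¹ ^ 2 * wavePacket (deriv (deriv a)) k L p.1‖ ≤ L⁻¹ * Ca := by
        rw [norm_mul, norm_pow, hLn, norm_wavePacket]
        exact mul_le_mul hLi (hCa _).2 (norm_nonneg _) (by positivity)
      have n2 : ‖2 * Complex.I * k * (L : ℂ)⁻¹ * wavePacket (deriv a) k L p.1‖
          ≤ 2 * |k| * L⁻¹ * Ca := by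
        rw [norm_mul, norm_mul, norm_mul, norm_mul, hLn, norm_wavePacket, Complex.norm_real,
          Complex.norm_I, Complex.norm_ofNat, mul_one, Real.norm_eq_abs]
        exact mul_le_mul_of_nonneg_left (hCa _).1 (by positivity)
      have n3 : ‖(L : ℂ)⁻¹ ^ 2 * wavePacket (deriv (deriv b)) 0 L p.2‖ ≤ L⁻¹ * Cb := by
        rw [norm_mul, norm_pow, hLn, norm_wavePacket]
        exact mul_le_mul hLi (hCb _).2 (norm_nonneg _) (by positivity)
      rw [h1]
      refine (norm_sub_le _ _).trans ?_
      rw [norm_neg, norm_mul, norm_mul (A p.1)]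
      calc _ ≤ (L⁻¹ * Ca + 2 * |k| * L⁻¹ * Ca) * 1 + 1 * (L⁻¹ * Cb) :=
            add_le_add (mul_le_mul ((norm_add_le _ _).trans (add_le_add n1 n2)) nB (norm_nonneg _)
              (by positivity)) (mul_le_mul nA n3 (norm_nonneg _) zero_le_one)
        _ = D / L := by rw [hD, div_eq_mul_inv]; ring
    have hzero : ∀ p ∉ S, r p = 0 := by
      intro p hp
      have h1 : p.1 ∉ tsupport A ∨ p.2 ∉ tsupport B := by
        by_contra! h
        have h2 := hAs h.1
        have h3 := hBs h.2
        exact hp ⟨⟨by nlinarith [h2.1], by linarith [h2.2]⟩, ⟨by nlinarith [h3.1], by linarith [h3.2]⟩⟩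
      simp only [hr, tensor]
      rcases h1 with h | h
      · have h2 : deriv (deriv A) p.1 = 0 := image_eq_zero_of_notMem_tsupport fun h3 =>
          h (closure_minimal support_deriv_subset (isClosed_tsupport A)
            (closure_minimal support_deriv_subset (isClosed_tsupport _) h3))
        rw [h2, image_eq_zero_of_notMem_tsupport h]; ring
      · have h2 : deriv (deriv B) p.2 = 0 := image_eq_zero_of_notMem_tsupport fun h3 =>
          h (closure_minimal support_deriv_subset (isClosed_tsupport B)
            (closure_minimal support_deriv_subset (isClosed_tsupport _) h3))
        rw [h2, image_eq_zero_of_notMem_tsupport h]; ring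
    have hDL : 0 ≤ D / L := by positivity
    have h1 : ‖hfm.toLp - ((k ^ 2 : ℝ) : ℂ) • hφm.toLp‖ₑ ^ 2 ≤ ENNReal.ofReal (D * 4) ^ 2 := by
      rw [enorm_sq_eq_lintegral_of_ae_eq hae]
      have hSm : MeasurableSet S := measurableSet_Icc.prod measurableSet_Icc
      calc ∫⁻ p in quadrant, ‖r p‖ₑ ^ 2 ≤ ∫⁻ p, ‖r p‖ₑ ^ 2 := setLIntegral_le_lintegral _ _
        _ ≤ ∫⁻ p, S.indicator (fun _ => ENNReal.ofReal (D / L) ^ 2) p := by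
            refine lintegral_mono fun p => ?_
            by_cases hp : p ∈ S
            · rw [indicator_of_mem hp, ← ofReal_norm]
              gcongr
              exact hbound p
            · simp [hzero p hp]
        _ = ENNReal.ofReal (D / L) ^ 2 * (ENNReal.ofReal (4 * L) * ENNReal.ofReal (4 * L)) := by
            rw [lintegral_indicator_const hSm, hS, volume_Icc_prod_Icc, sub_zero]
        _ = (ENNReal.ofReal (D / L) * ENNReal.ofReal (4 * L)) ^ 2 := by ring
        _ = ENNReal.ofReal (D * 4) ^ 2 := by
            rw [← ENNReal.ofReal_mul hDL]
            congr 2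
            field_simp
    have h2 := (ENNReal.pow_le_pow_left_iff two_ne_zero).1 h1
    rw [← ofReal_norm] at h2
    exact (ENNReal.ofReal_le_ofReal_iff (by positivity)).1 h2

/-- Approximate eigenfunctions exclude a bounded resolvent. -/
lemma mem_opSpectrum_of_nonneg (σ α : LinfR) {t : ℝ} (ht : 0 ≤ t) :
    (t : ℂ) ∈ opSpectrum (robinLaplacian σ α) := by
  rintro ⟨R, -, hR⟩
  obtain ⟨M, hM⟩ := exists_quasimode σ α √t
  rw [Real.sq_sqrt ht] at hM
  obtain ⟨φ, f, hφ, hlow, hup⟩ := hM (max 1 (2 * (‖R‖ * M) + 2)) (le_max_left _ _)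
  obtain ⟨ψ, hψ1, hψ2⟩ := (LinearPMap.mem_graph_iff _).1 hφ
  simp only at hψ1 hψ2
  have h1 := hR ψ
  rw [hψ1, hψ2] at h1
  have h2 : ‖φ‖ ≤ ‖R‖ * M := by
    rw [← h1]
    exact (R.le_opNorm _).trans (by gcongr)
  linarith [le_max_right 1 (2 * (‖R‖ * M) + 2)]

/-- No point of `[0,∞)` is isolated in the spectrum. -/
lemma subset_essentialSpectrum (σ α : LinfR) :
    (fun t : ℝ => (t : ℂ)) '' Ici 0 ⊆ essentialSpectrum (robinLaplacian σ α) := by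
  rintro _ ⟨t, ht, rfl⟩
  refine ⟨mem_opSpectrum_of_nonneg σ α ht, fun h => ?_⟩
  have h1 : Tendsto (fun s : ℝ => (s : ℂ)) (𝓝[>] t) (𝓝[≠] (t : ℂ)) := by
    refine tendsto_nhdsWithin_iff.2 ⟨(Complex.continuous_ofReal.tendsto t).mono_left
      nhdsWithin_le_nhds, ?_⟩
    filter_upwards [self_mem_nhdsWithin] with s hs
    simpa using ne_of_gt hs
  obtain ⟨s, hs1, hs2⟩ := ((h1.eventually h.2.1).and self_mem_nhdsWithin).exists
  exact hs1 (mem_opSpectrum_of_nonneg σ α (ht.trans (le_of_lt hs2)))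

end QuarterPlane

theorem mainTheorem10 (σ α : QuarterPlane.LinfR) :
    ((fun t : ℝ => (t : ℂ)) '' Set.Ici 0 ⊆
      QuarterPlane.essentialSpectrum (QuarterPlane.robinLaplacian σ α)) ∧
    (Filter.Tendsto σ (Filter.atTop ⊓ MeasureTheory.ae QuarterPlane.μR) (nhds 0) →
      Filter.Tendsto α (Filter.atTop ⊓ MeasureTheory.ae QuarterPlane.μR) (nhds 0) →
      QuarterPlane.essentialSpectrum (QuarterPlane.robinLaplacian σ α) =
        (fun t : ℝ => (t : ℂ)) '' Set.Ici 0) :=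
  ⟨QuarterPlane.subset_essentialSpectrum σ α, fun hσ hα =>
    (QuarterPlane.essentialSpectrum_subset σ α
      (QuarterPlane.isCompactOperator_interactionOp hσ hα)).antisymm
      (QuarterPlane.subset_essentialSpectrum σ α)⟩
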